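/- Let $L>0$. Let $M\subset L^2(0,L)$ be the finite-dimensional real subspace spanned by the real and imaginary parts of all $\varphi\in C^\infty([0,L];\mathbb{C})$ for which there are integers $l\ge k\ge 1$ with $L=2\pi\sqrt{(l^2+lk+k^2)/3}$ such that, with $\omega(l,k)=\frac{(2l+k)(l-k)(2k+l)}{3\sqrt3\,(l^2+lk+k^2)^{3/2}}$, $$-i\,\omega(l,k)\,\varphi+\varphi'+\varphi'''=0\ \text{ on } [0,L],\qquad \varphi(0)=\varphi(L)=\varphi'(0)=\varphi'(L)=0 ,$$ let $H=M^\perp$, and let $P_H,P_M$ be the orthogonal projections of $L^2(0,L)$ onto $H$ and $M$. For $T_1<T_2$ put $\mathcal{B}_{T_1,T_2}=C^0([T_1,T_2];L^2(0,L))\cap L^2(T_1,T_2;H^1(0,L))$. For $f\in L^1(T_1,T_2;L^2(0,L))$, $h\in L^2(T_1,T_2)$ and $z_0\in L^2(0,L)$, a solution on $[T_1,T_2]$ of $$z_t+z_{xxx}+z_x=f,\quad z(t,0)=z(t,L)=0,\quad z_x(t,L)=h(t),\quad z(T_1,\cdot)=z_0 \qquad (1)$$ is a function $z\in L^1(T_1,T_2;L^2(0,L))$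 such that, for almost every $\tau\in[T_1,T_2]$ and for every $\phi\in C^3([T_1,\tau]\times[0,L])$ with $\phi(t,0)=\phi(t,L)=\phi_x(t,0)=0$ for all $t\in[T_1,\tau]$, $$-\int_{T_1}^{\tau}\!\!\int_0^L(\phi_t+\phi_x+\phi_{xxx})z\,dx\,dt-\int_{T_1}^{\tau}h(t)\phi_x(t,L)\,dt-\int_{T_1}^{\tau}\!\!\int_0^L\phi f\,dx\,dt+\int_0^Lz(\tau,x)\phi(\tau,x)\,dx-\int_0^Lz_0(x)\phi(T_1,x)\,dx=0 .$$ Let $u:\mathbb{R}\times L^2(0,L)\to\mathbb{R}$ be a Carathéodory feedback law: for every $R>0$ it is bounded on $\mathbb{R}\times\{\|z\|_{L^2}\le R\}$; $t\mapsto u(t,z)$ is measurable for every $z\in L^2(0,L)$; and $z\mapsto u(t,z)$ is continuous for almost every $t$. Let $-\infty<s<T<+\infty$, $y\in\mathcal{B}_{s,T}$ and $y_0\in L^2(0,L)$, and put $y_1=P_H(y)$, $y_2=P_M(y)$. Then the following are equivalent. (a) $y$ is a solution on $[s,T]$ of the closed-loop Cauchy problem $y_t+y_{xxx}+y_x+yy_x=0$,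 $y(t,0)=y(t,L)=0$, $y_x(t,L)=u(t,y(t,\cdot))$, $y(s,\cdot)=y_0$; that is, $y(s)=y_0$ and, for every $[T_1,T_2]\subset[s,T]$ with $T_1<T_2$, one has $y\in\mathcal{B}_{T_1,T_2}$ and $y$ solves (1) on $[T_1,T_2]$ with $f=-yy_x$, $h(t)=u(t,y(t))$, $z_0=y(T_1)$. (b) $(y_1,y_2)$ is a solution on $[s,T]$ of the coupled system; that is, $y_1,y_2\in\mathcal{B}_{s,T}$, $y_1$ solves (1) on $[s,T]$ with $f=-P_H\big((y_1+y_2)(y_1+y_2)_x\big)$, $h(t)=u(t,y_1(t)+y_2(t))$, $z_0=P_H(y_0)$, and $y_2$ solves (1) on $[s,T]$ with $f=-P_M\big((y_1+y_2)(y_1+y_2)_x\big)$, $h=0$, $z_0=P_M(y_0)$. -/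

import Mathlib

open MeasureTheory Set
open scoped ContDiff

noncomputable section

namespace KdV

/-- The real Hilbert space `L²(0,L)`. -/
abbrev L2 (L : ℝ) : Type := Lp ℝ 2 (volume.restrict (Ioo (0 : ℝ) L))

/-! ### The subspaces `M`, `H` and the orthogonal projections onto them -/

/-- The frequency `ω(l,k)`. -/
def freq (l k : ℕ) : ℝ :=
  ((2 * l + k) * ((l : ℝ) - k) * (2 * k + l)) /
    (3 * Real.sqrt 3 * ((l : ℝ) ^ 2 + l * k + k ^ 2) ^ (3 / 2 : ℝ))

/-- The pairs `(l,k)` of positive integers with `l ≥ k` and `L = 2π √((l² + lk + k²)/3)`. -/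
def critPairs (L : ℝ) : Set (ℕ × ℕ) :=
  {p | 1 ≤ p.2 ∧ p.2 ≤ p.1 ∧
    L = 2 * Real.pi * Real.sqrt (((p.1 : ℝ) ^ 2 + p.1 * p.2 + (p.2 : ℝ) ^ 2) / 3)}

/-- `φ` is a smooth solution on `[0,L]` of `-iwφ + φ' + φ''' = 0` with
`φ(0) = φ(L) = φ'(0) = φ'(L) = 0`. Functions that are smooth on `[0,L]` are represented by
smooth extensions to `ℝ`; nothing is asked of the extension outside `[0,L]`. -/
structure IsMode (L w : ℝ) (φ : ℝ → ℂ) : Prop where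
  smooth : ContDiff ℝ ∞ φ
  ode : ∀ x ∈ Icc 0 L, -(Complex.I * w) * φ x + deriv φ x + iteratedDeriv 3 φ x = 0
  left : φ 0 = 0
  right : φ L = 0
  deriv_left : deriv φ 0 = 0
  deriv_right : deriv φ L = 0

/-- The elements of `L²(0,L)` which are the real or the imaginary part of a mode of frequency
`w`. The modes of a given frequency form a complex vector space of dimension at most one, so that
these elements span the same space as the real and the imaginary part of one nonzero mode. -/
def modeParts (L w : ℝ) : Set (L2 L) :=
  {f | ∃ φ : ℝ → ℂ, IsMode L w φ ∧
    ((f : ℝ → ℝ) =ᵐ[volume.restrict (Ioo (0 : ℝ) L)] (fun x => (φ x).re) ∨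
      (f : ℝ → ℝ) =ᵐ[volume.restrict (Ioo (0 : ℝ) L)] (fun x => (φ x).im))}

/-- The uncontrollable space `M`: the real span of the real and imaginary parts of the modes of
frequency `ω(l,k)`, for all pairs `(l,k)` attached to `L`. -/
def M (L : ℝ) : Submodule ℝ (L2 L) :=
  Submodule.span ℝ (⋃ p ∈ critPairs L, modeParts L (freq p.1 p.2))

/-- The controllable space `H`, the orthogonal complement of `M` in `L²(0,L)`. -/
def H (L : ℝ) : Submodule ℝ (L2 L) := (M L)ᗮ

theorem critPairs_finite (L : ℝ) : (critPairs L).Finite := by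
  obtain ⟨N, hN⟩ := exists_nat_gt (3 * (L / (2 * Real.pi)) ^ 2)
  refine ((Set.finite_Iio N).prod (Set.finite_Iio N)).subset ?_
  rintro ⟨l, k⟩ ⟨hk, hkl, h⟩
  simp only at hk hkl h
  have hpi : (0 : ℝ) < 2 * Real.pi := by positivity
  have h1 : (L / (2 * Real.pi)) ^ 2 = ((l : ℝ) ^ 2 + l * k + (k : ℝ) ^ 2) / 3 := by
    rw [h, mul_div_cancel_left₀ _ hpi.ne', Real.sq_sqrt (by positivity)]
  rw [h1] at hN
  have hk' : (1 : ℝ) ≤ k := by exact_mod_cast hk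
  have hkl' : (k : ℝ) ≤ l := by exact_mod_cast hkl
  have hl : (l : ℝ) < N := by nlinarith
  have hl' : l < N := by exact_mod_cast hl
  exact ⟨hl', lt_of_le_of_lt hkl hl'⟩

/-- A mode is determined on `[0,L]` by its second derivative at `0`, up to a common factor. -/
theorem IsMode.unique {L w : ℝ} {φ ψ : ℝ → ℂ} (hφ : IsMode L w φ) (hψ : IsMode L w ψ)
    (c : ℂ) (h0 : iteratedDeriv 2 φ 0 = c * iteratedDeriv 2 ψ 0) :
    EqOn φ (fun x => c * ψ x) (Icc 0 L) := by
  let A : ℂ × ℂ × ℂ →L[ℝ] ℂ × ℂ × ℂ :=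
    ((ContinuousLinearMap.fst ℝ ℂ ℂ).comp (ContinuousLinearMap.snd ℝ ℂ (ℂ × ℂ))).prod
      (((ContinuousLinearMap.snd ℝ ℂ ℂ).comp (ContinuousLinearMap.snd ℝ ℂ (ℂ × ℂ))).prod
        ((ContinuousLinearMap.mul ℝ ℂ (Complex.I * w)).comp (ContinuousLinearMap.fst ℝ ℂ (ℂ × ℂ)) -
          (ContinuousLinearMap.fst ℝ ℂ ℂ).comp (ContinuousLinearMap.snd ℝ ℂ (ℂ × ℂ))))
  have key : ∀ (χ : ℝ → ℂ), IsMode L w χ → ∀ d : ℂ,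
      ∀ t ∈ Icc 0 L, HasDerivAt (fun x => (d * χ x, d * deriv χ x, d * iteratedDeriv 2 χ x))
        (A (d * χ t, d * deriv χ t, d * iteratedDeriv 2 χ t)) t := by
    intro χ hχ d t ht
    have e0 : HasDerivAt χ (deriv χ t) t :=
      (hχ.smooth.differentiable (by simp) t).hasDerivAt
    have e1 : HasDerivAt (deriv χ) (iteratedDeriv 2 χ t) t := by
      have := (hχ.smooth.differentiable_iteratedDeriv 1 (mod_cast WithTop.coe_lt_top (1 : ℕ))
        t).hasDerivAt
      rwa [iteratedDeriv_one, ← iteratedDeriv_one, ← iteratedDeriv_succ, iteratedDeriv_one] at this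
    have e2 : HasDerivAt (iteratedDeriv 2 χ) (iteratedDeriv 3 χ t) t := by
      have := (hχ.smooth.differentiable_iteratedDeriv 2 (WithTop.coe_lt_coe.2 (ENat.natCast_lt_top 2))
        t).hasDerivAt
      rwa [← iteratedDeriv_succ] at this
    have e3 : d * iteratedDeriv 3 χ t = Complex.I * w * (d * χ t) - d * deriv χ t := by
      linear_combination d * hχ.ode t ht
    have := (e0.const_mul d).prodMk ((e1.const_mul d).prodMk (e2.const_mul d))
    rw [e3] at this
    exact this
  have hE := ODE_solution_unique (v := fun _ => A) (a := 0) (b := L)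
    (f := fun x => (1 * φ x, 1 * deriv φ x, 1 * iteratedDeriv 2 φ x))
    (g := fun x => (c * ψ x, c * deriv ψ x, c * iteratedDeriv 2 ψ x))
    (fun _ => A.lipschitz)
    (fun t ht => (key φ hφ 1 t ht).continuousAt.continuousWithinAt)
    (fun t ht => (key φ hφ 1 t ⟨ht.1, ht.2.le⟩).hasDerivWithinAt)
    (fun t ht => (key ψ hψ c t ht).continuousAt.continuousWithinAt)
    (fun t ht => (key ψ hψ c t ⟨ht.1, ht.2.le⟩).hasDerivWithinAt)
    (by simp [hφ.left, hφ.deriv_left, hψ.left, hψ.deriv_left, h0])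
  intro x hx
  simpa using congrArg Prod.fst (hE hx)

theorem modeParts_finite (L w : ℝ) : ∃ S : Set (L2 L), S.Finite ∧
    modeParts L w ⊆ Submodule.span ℝ S := by
  classical
  -- a mode that generates all of them on `[0,L]`
  have hgen : ∃ ψ : ℝ → ℂ, Continuous ψ ∧
      ∀ φ, IsMode L w φ → ∃ c : ℂ, EqOn φ (fun x => c * ψ x) (Icc 0 L) := by
    by_cases h : ∃ ψ, IsMode L w ψ ∧ iteratedDeriv 2 ψ 0 ≠ 0
    · obtain ⟨ψ, hψ, h2⟩ := h
      exact ⟨ψ, hψ.smooth.continuous, fun φ hφ =>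
        ⟨iteratedDeriv 2 φ 0 / iteratedDeriv 2 ψ 0, hφ.unique hψ _ (by field_simp)⟩⟩
    · push Not at h
      refine ⟨0, continuous_zero, fun φ hφ => ⟨0, ?_⟩⟩
      have := hφ.unique hφ 0 (by simp [h φ hφ])
      intro x hx
      simpa using this hx
  obtain ⟨ψ, hc, hψ⟩ := hgen
  have mem : ∀ g : ℝ → ℝ, Continuous g → MemLp g 2 (volume.restrict (Ioo (0 : ℝ) L)) := by
    intro g hg
    obtain ⟨C, hC⟩ := isCompact_Icc.exists_bound_of_continuousOn (s := Icc (0 : ℝ) L)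
      hg.continuousOn
    refine MemLp.of_bound hg.aestronglyMeasurable C ?_
    filter_upwards [ae_restrict_mem measurableSet_Ioo] with x hx
    exact hC x (Ioo_subset_Icc_self hx)
  let fr : L2 L := (mem _ (Complex.continuous_re.comp hc)).toLp
  let fi : L2 L := (mem _ (Complex.continuous_im.comp hc)).toLp
  have hfr : fr =ᵐ[volume.restrict (Ioo (0 : ℝ) L)] fun x => (ψ x).re := MemLp.coeFn_toLp _
  have hfi : fi =ᵐ[volume.restrict (Ioo (0 : ℝ) L)] fun x => (ψ x).im := MemLp.coeFn_toLp _
  refine ⟨{fr, fi}, by simp, ?_⟩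
  rintro f ⟨φ, hφ, hf⟩
  obtain ⟨c, hcφ⟩ := hψ φ hφ
  rw [SetLike.mem_coe, Submodule.mem_span_pair]
  have hin : ∀ᵐ x ∂(volume.restrict (Ioo (0 : ℝ) L)), x ∈ Ioo (0 : ℝ) L :=
    ae_restrict_mem measurableSet_Ioo
  rcases hf with hf | hf
  · refine ⟨c.re, -c.im, ?_⟩
    apply Lp.ext
    filter_upwards [hf, hfr, hfi, hin, Lp.coeFn_add (c.re • fr) ((-c.im) • fi),
      Lp.coeFn_smul c.re fr, Lp.coeFn_smul (-c.im) fi] with x h1 h2 h3 h4 h5 h6 h7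
    rw [h5, Pi.add_apply, h6, h7, Pi.smul_apply, Pi.smul_apply, h1, h2, h3,
      hcφ (Ioo_subset_Icc_self h4)]
    simp [Complex.mul_re, sub_eq_add_neg]
  · refine ⟨c.im, c.re, ?_⟩
    apply Lp.ext
    filter_upwards [hf, hfr, hfi, hin, Lp.coeFn_add (c.im • fr) (c.re • fi),
      Lp.coeFn_smul c.im fr, Lp.coeFn_smul c.re fi] with x h1 h2 h3 h4 h5 h6 h7
    rw [h5, Pi.add_apply, h6, h7, Pi.smul_apply, Pi.smul_apply, h1, h2, h3,
      hcφ (Ioo_subset_Icc_self h4)]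
    simp [Complex.mul_im, add_comm]

theorem finiteDimensional_span_biUnion {V ι : Type*} [AddCommGroup V] [Module ℝ V] {P : Set ι}
    (hP : P.Finite) {A : ι → Set V}
    (hA : ∀ i, ∃ S : Set V, S.Finite ∧ A i ⊆ Submodule.span ℝ S) :
    FiniteDimensional ℝ (Submodule.span ℝ (⋃ i ∈ P, A i)) := by
  choose S hS hsub using hA
  have hfin : (⋃ i ∈ P, S i).Finite := hP.biUnion fun i _ => hS i
  have := FiniteDimensional.span_of_finite ℝ hfin
  refine Submodule.finiteDimensional_of_le (S₂ := Submodule.span ℝ (⋃ i ∈ P, S i)) ?_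
  refine Submodule.span_le.2 (iUnion₂_subset fun i hi => (hsub i).trans ?_)
  exact Submodule.span_mono (subset_biUnion_of_mem (u := S) hi)

/-- `M` is finite dimensional, so that the orthogonal projection onto it exists. -/
instance finiteDimensional_M (L : ℝ) : FiniteDimensional ℝ (M L) :=
  finiteDimensional_span_biUnion (critPairs_finite L) fun _ => modeParts_finite L _

instance hasOrthogonalProjection_M (L : ℝ) : (M L).HasOrthogonalProjection :=
  Submodule.HasOrthogonalProjection.ofCompleteSpace (M L)

instance hasOrthogonalProjection_H (L : ℝ) : (H L).HasOrthogonalProjection := 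
  inferInstanceAs (M L)ᗮ.HasOrthogonalProjection

/-- The orthogonal projection `P_H` of `L²(0,L)` onto `H`. -/
def PH (L : ℝ) : L2 L →L[ℝ] L2 L := (H L).starProjection

/-- The orthogonal projection `P_M` of `L²(0,L)` onto `M`. -/
def PM (L : ℝ) : L2 L →L[ℝ] L2 L := (M L).starProjection

/-! ### Weak derivatives, the space `𝓑`, and the nonlinearity -/

/-- `g` is the weak derivative of `f` on `(0,L)`. -/
def IsWeakDeriv {L : ℝ} (f g : L2 L) : Prop :=
  ∀ ψ : ℝ → ℝ, ContDiff ℝ ∞ ψ → HasCompactSupport ψ → tsupport ψ ⊆ Ioo 0 L →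
    ∫ x in Ioo 0 L, f x * deriv ψ x = -∫ x in Ioo 0 L, g x * ψ x

/-- `f ∈ H¹(0,L)`. -/
def InH1 {L : ℝ} (f : L2 L) : Prop := ∃ g : L2 L, IsWeakDeriv f g

open Classical in
/-- The weak derivative `f_x ∈ L²(0,L)` of `f ∈ H¹(0,L)`; it is `0` if `f ∉ H¹(0,L)`. -/
def weakDeriv {L : ℝ} (f : L2 L) : L2 L := if h : InH1 f then h.choose else 0

/-- `y ∈ 𝓑_{T₁,T₂} = C⁰([T₁,T₂]; L²(0,L)) ∩ L²(T₁,T₂; H¹(0,L))`. Functions on `[T₁,T₂]` are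
represented by functions on `ℝ` whose values outside `[T₁,T₂]` are irrelevant. -/
structure MemB {L : ℝ} (T₁ T₂ : ℝ) (y : ℝ → L2 L) : Prop where
  continuousOn : ContinuousOn y (Icc T₁ T₂)
  inH1 : ∀ᵐ t ∂(volume.restrict (Icc T₁ T₂)), InH1 (y t)
  memLp_deriv : MemLp (fun t => weakDeriv (y t)) 2 (volume.restrict (Icc T₁ T₂))

open Classical in
/-- The pointwise product of two functions as an element of `L²(0,L)` (`0` if it is not
square integrable). -/
def mulL2 {L : ℝ} (f g : L2 L) : L2 L :=
  if h : MemLp (fun x => f x * g x) 2 (volume.restrict (Ioo (0 : ℝ) L)) then h.toLp else 0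

/-- The nonlinear term `f f_x`, which is in `L²(0,L)` for `f ∈ H¹(0,L)`. -/
def nonlin {L : ℝ} (f : L2 L) : L2 L := mulL2 f (weakDeriv f)

/-! ### Solutions -/

/-- `φ` is a test function on `[T₁,τ] × [0,L]`: it is of class `C³` and
`φ(t,0) = φ(t,L) = φ_x(t,0) = 0` for all `t ∈ [T₁,τ]`. Functions of class `C³` on the closed
rectangle are represented by extensions of class `C³` to `ℝ × ℝ`. -/
structure IsTest (L T₁ τ : ℝ) (φ : ℝ → ℝ → ℝ) : Prop where
  contDiff : ContDiff ℝ 3 (fun p : ℝ × ℝ => φ p.1 p.2)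
  left : ∀ t ∈ Icc T₁ τ, φ t 0 = 0
  right : ∀ t ∈ Icc T₁ τ, φ t L = 0
  deriv_left : ∀ t ∈ Icc T₁ τ, deriv (φ t) 0 = 0

/-- `y` is a (weak) solution on `[T₁,T₂]` of the linear Cauchy problem
`y_t + y_xxx + y_x = f`, `y(t,0) = y(t,L) = 0`, `y_x(t,L) = h(t)`, `y(T₁,·) = y₀`,
with data `f ∈ L¹(T₁,T₂; L²(0,L))`, `h ∈ L²(T₁,T₂)`, `y₀ ∈ L²(0,L)`. -/
structure IsLinearSolution {L : ℝ} (T₁ T₂ : ℝ) (f : ℝ → L2 L) (h : ℝ → ℝ) (y₀ : L2 L)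
    (y : ℝ → L2 L) : Prop where
  forcing : IntegrableOn f (Icc T₁ T₂)
  boundary : MemLp h 2 (volume.restrict (Icc T₁ T₂))
  integrable : IntegrableOn y (Icc T₁ T₂)
  weak : ∀ᵐ τ ∂(volume.restrict (Icc T₁ T₂)), ∀ φ : ℝ → ℝ → ℝ, IsTest L T₁ τ φ →
    -(∫ t in T₁..τ, ∫ x in Ioo 0 L,
        (deriv (fun r => φ r x) t + deriv (φ t) x + iteratedDeriv 3 (φ t) x) * y t x)
      - (∫ t in T₁..τ, h t * deriv (φ t) L)
      - (∫ t in T₁..τ, ∫ x in Ioo 0 L, φ t x * f t x)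
      + (∫ x in Ioo 0 L, y τ x * φ τ x)
      - (∫ x in Ioo 0 L, y₀ x * φ T₁ x) = 0

/-- `y` is a solution on `[T₁,T₂]` of the nonlinear Cauchy problem
`y_t + y_xxx + y_x + y y_x = f`, `y(t,0) = y(t,L) = 0`, `y_x(t,L) = h(t)`, `y(T₁,·) = y₀`. -/
structure IsNonlinearSolution {L : ℝ} (T₁ T₂ : ℝ) (f : ℝ → L2 L) (h : ℝ → ℝ) (y₀ : L2 L)
    (y : ℝ → L2 L) : Prop where
  memB : MemB T₁ T₂ y
  linear : IsLinearSolution T₁ T₂ (fun t => f t - nonlin (y t)) h y₀ y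

/-- Carathéodory feedback laws `u : ℝ × L²(0,L) → ℝ`. Measurability in `t` is Lebesgue
measurability. -/
structure IsCaratheodory {L : ℝ} (u : ℝ → L2 L → ℝ) : Prop where
  bounded : ∀ R : ℝ, 0 < R → ∃ C : ℝ, 0 < C ∧ ∀ z : L2 L, ‖z‖ ≤ R → ∀ t : ℝ, |u t z| ≤ C
  measurable : ∀ z : L2 L, AEMeasurable (fun t => u t z) volume
  continuous : ∀ᵐ t : ℝ, Continuous (u t)

/-- `y` is a solution on the interval `I` of the closed-loop system
`y_t + y_xxx + y_x + y y_x = 0`, `y(t,0) = y(t,L) = 0`, `y_x(t,L) = u(t,y(t,·))`. -/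
structure IsClosedLoopSolutionOn {L : ℝ} (u : ℝ → L2 L → ℝ) (I : Set ℝ) (y : ℝ → L2 L) :
    Prop where
  continuousOn : ContinuousOn y I
  solution : ∀ T₁ T₂ : ℝ, T₁ < T₂ → Icc T₁ T₂ ⊆ I →
    IsNonlinearSolution T₁ T₂ (fun _ => 0) (fun t => u t (y t)) (y T₁) y

/-- `y`, defined on the interval `I = D(y)`, is a solution of the closed-loop Cauchy problem
with initial condition `y(s,·) = y₀`. -/
structure IsClosedLoopCauchySolution {L : ℝ} (u : ℝ → L2 L → ℝ) (s : ℝ) (y₀ : L2 L)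
    (I : Set ℝ) (y : ℝ → L2 L) : Prop where
  interval : I.OrdConnected
  interior_nonempty : (interior I).Nonempty
  starts_at : I ∩ Iic s = {s}
  closedLoop : IsClosedLoopSolutionOn u I y
  initial : y s = y₀

/-- `(y₁,y₂)` is a solution on `[s,T]` of the coupled system
`y₁_t + y₁_x + y₁_xxx + P_H((y₁+y₂)(y₁+y₂)_x) = 0`, `y₁(t,0) = y₁(t,L) = 0`,
`y₁_x(t,L) = u(t,y₁+y₂)`, `y₁(s,·) = P_H y₀`,
`y₂_t + y₂_x + y₂_xxx + P_M((y₁+y₂)(y₁+y₂)_x) = 0`, `y₂(t,0) = y₂(t,L) = 0`,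
`y₂_x(t,L) = 0`, `y₂(s,·) = P_M y₀`. -/
structure IsCoupledSolution {L : ℝ} (u : ℝ → L2 L → ℝ) (s T : ℝ) (y₀ : L2 L)
    (y₁ y₂ : ℝ → L2 L) : Prop where
  memB₁ : MemB s T y₁
  memB₂ : MemB s T y₂
  linear₁ : IsLinearSolution s T (fun t => -PH L (nonlin (y₁ t + y₂ t)))
    (fun t => u t (y₁ t + y₂ t)) (PH L y₀) y₁
  linear₂ : IsLinearSolution s T (fun t => -PM L (nonlin (y₁ t + y₂ t)))
    (fun _ => 0) (PM L y₀) y₂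

end KdV

end

noncomputable section

namespace KdV

/-! ### Classes of continuous functions -/

/-! The real and imaginary parts of a mode vanish to second order at both ends, and `φ' + φ''' =
iωφ` makes `∂ₓ + ∂ₓ³` exchange them up to the factors `∓ω`. Hence `M` is a finite-dimensional space
of smooth functions, invariant under `∂ₓ + ∂ₓ³`, and the operator is antisymmetric between `M` and
the functions satisfying the boundary conditions of a test function (`integral_airy_mul`).

Consequently `P_M` respects the weak formulation (`IsTest.exists_projection`): if `φ` is a test
function, so is `ψ = P_M φ`, with `ψ_x(t,L) = 0`, and pairing the adjoint operator of `ψ` with `z`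
amounts to pairing that of `φ` with `P_M z`. Testing the equation of `y` with `ψ` therefore gives
the equation of `P_M y`, with projected forcing and initial datum and with no boundary control
(`WeakIdentity.PM`). Subtracting it from the equation of `y` gives that of `P_H y`; this is (a) ⇒
(b).

Conversely the two equations of the coupled system add up to the equation of `y` on `[s,T]`
(`weakIdentity_add_iff`). Two things remain for (a). The continuity of `y` forces `y(s) = y₀`
(`initial_eq_of_weakIdentity`), and the weak formulation has to be restarted from `y(T₁)` at any `T₁
> s`, which is done by multiplying test functions by a smooth cutoff in time
(`weakIdentity_restart`). -/

theorem memLp_of_continuous (L : ℝ) {g : ℝ → ℝ} (hg : Continuous g) :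
    MemLp g 2 (volume.restrict (Ioo (0 : ℝ) L)) := by
  obtain ⟨C, hC⟩ := isCompact_Icc.exists_bound_of_continuousOn (s := Icc (0 : ℝ) L)
    hg.continuousOn
  refine MemLp.of_bound hg.aestronglyMeasurable C ?_
  filter_upwards [ae_restrict_mem measurableSet_Ioo] with x hx
  exact hC x (Ioo_subset_Icc_self hx)

open Classical in
/-- The class in `L²(0,L)` of a square integrable function (`0` for other functions). -/
def toL2 (L : ℝ) (g : ℝ → ℝ) : L2 L :=
  if h : MemLp g 2 (volume.restrict (Ioo (0 : ℝ) L)) then h.toLp else 0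

theorem coeFn_toL2 (L : ℝ) {g : ℝ → ℝ} (hg : Continuous g) :
    (toL2 L g : ℝ → ℝ) =ᵐ[volume.restrict (Ioo (0 : ℝ) L)] g := by
  rw [toL2, dif_pos (memLp_of_continuous L hg)]
  exact MemLp.coeFn_toLp _

theorem integral_mul_eq_inner {L : ℝ} {g : ℝ → ℝ} (hg : Continuous g) (f : L2 L) :
    ∫ x in Ioo 0 L, g x * f x = inner ℝ (toL2 L g) f := by
  rw [L2.inner_def]
  refine integral_congr_ae ?_
  filter_upwards [coeFn_toL2 L hg] with x hx
  simp [hx, mul_comm]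

theorem integral_mul_eq_inner' {L : ℝ} {g : ℝ → ℝ} (hg : Continuous g) (f : L2 L) :
    ∫ x in Ioo 0 L, f x * g x = inner ℝ (toL2 L g) f := by
  rw [← integral_mul_eq_inner hg]
  simp only [mul_comm]

theorem inner_toL2_toL2 (L : ℝ) {g h : ℝ → ℝ} (hg : Continuous g) (hh : Continuous h) :
    inner ℝ (toL2 L g) (toL2 L h) = ∫ x in Ioo 0 L, g x * h x := by
  rw [← integral_mul_eq_inner hg]
  refine integral_congr_ae ?_
  filter_upwards [coeFn_toL2 L hh] with x hx
  rw [hx]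

theorem toL2_add (L : ℝ) {g h : ℝ → ℝ} (hg : Continuous g) (hh : Continuous h) :
    toL2 L (fun x => g x + h x) = toL2 L g + toL2 L h := by
  apply Lp.ext
  filter_upwards [coeFn_toL2 L hg, coeFn_toL2 L hh, coeFn_toL2 L (hg.add hh),
    Lp.coeFn_add (toL2 L g) (toL2 L h)] with x h1 h2 h3 h4
  exact h3.trans (by rw [h4]; simp only [Pi.add_apply, h1, h2])

theorem toL2_const_mul (L c : ℝ) {g : ℝ → ℝ} (hg : Continuous g) :
    toL2 L (fun x => c * g x) = c • toL2 L g := by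
  apply Lp.ext
  filter_upwards [coeFn_toL2 L hg, coeFn_toL2 L (hg.const_mul c),
    Lp.coeFn_smul c (toL2 L g)] with x h1 h2 h3
  simpa [h3, h1] using h2

theorem toL2_sum (L : ℝ) {ι : Type*} (S : Finset ι) {g : ι → ℝ → ℝ}
    (hg : ∀ i, Continuous (g i)) :
    toL2 L (fun x => ∑ i ∈ S, g i x) = ∑ i ∈ S, toL2 L (g i) := by
  classical
  induction S using Finset.induction_on with
  | empty =>
    have := toL2_const_mul L 0 (g := fun _ => 0) continuous_const
    simpa using this
  | insert i S hi ih =>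
    simp only [Finset.sum_insert hi]
    rw [toL2_add L (hg i) (by fun_prop), ih]

theorem toL2_congr {L : ℝ} {g h : ℝ → ℝ} (hg : Continuous g) (hh : Continuous h)
    (hgh : EqOn g h (Ioo 0 L)) : toL2 L g = toL2 L h := by
  apply Lp.ext
  filter_upwards [coeFn_toL2 L hg, coeFn_toL2 L hh, ae_restrict_mem measurableSet_Ioo]
    with x h1 h2 h3
  rw [h1, h2, hgh h3]

theorem toL2_eq_of_ae {L : ℝ} {g : ℝ → ℝ} (hg : Continuous g) {f : L2 L}
    (h : (f : ℝ → ℝ) =ᵐ[volume.restrict (Ioo (0 : ℝ) L)] g) : toL2 L g = f :=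
  Lp.ext ((coeFn_toL2 L hg).trans h.symm)

/-- Currying turns joint continuity into continuity for uniform convergence on `[0,L]`, and on a set
of finite measure the sup norm controls the `L²` norm. -/
theorem continuous_toL2 (L : ℝ) {g : ℝ → ℝ → ℝ} (hg : Continuous fun p : ℝ × ℝ => g p.1 p.2) :
    Continuous fun t => toL2 L (g t) := by
  have hgt : ∀ t, Continuous (g t) := fun t => hg.comp (by fun_prop : Continuous fun x => (t, x))
  set K : ℝ := (volume.restrict (Ioo (0 : ℝ) L)).real univ ^ (2 : ENNReal).toReal⁻¹ with hK
  have hK0 : 0 ≤ K := by positivity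
  rw [continuous_iff_continuousAt]
  intro t₀
  rw [ContinuousAt, Metric.tendsto_nhds]
  intro ε hε
  let G : C(ℝ, C(ℝ, ℝ)) := ContinuousMap.curry ⟨fun p : ℝ × ℝ => g p.1 p.2, hg⟩
  have hT := (ContinuousMap.tendsto_iff_forall_isCompact_tendstoUniformlyOn.1
    (G.continuous.tendsto t₀)) (Icc 0 L) isCompact_Icc
  rw [Metric.tendstoUniformlyOn_iff] at hT
  -- `K` is zero when `L ≤ 0`; using `K + 1` avoids dividing by it and makes the final bound strict.
  filter_upwards [hT (ε / (K + 1)) (by positivity)] with t ht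
  have hb : ‖toL2 L (g t) - toL2 L (g t₀)‖ ≤ K * (ε / (K + 1)) := by
    refine Lp.norm_le_of_ae_bound (by positivity) ?_
    filter_upwards [coeFn_toL2 L (hgt t), coeFn_toL2 L (hgt t₀),
      Lp.coeFn_sub (toL2 L (g t)) (toL2 L (g t₀)), ae_restrict_mem measurableSet_Ioo]
      with x h1 h2 h3 h4
    rw [h3, Pi.sub_apply, h1, h2, ← dist_eq_norm, dist_comm]
    exact (ht x (Ioo_subset_Icc_self h4)).le
  rw [dist_eq_norm]
  refine hb.trans_lt ?_
  rw [mul_div_assoc', div_lt_iff₀ (by positivity)]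
  nlinarith

/-! ### Partial derivatives and parametric integrals -/

theorem hasDerivAt_left {n : WithTop ℕ∞} (hn : n ≠ 0) {φ : ℝ → ℝ → ℝ}
    (hφ : ContDiff ℝ n fun p : ℝ × ℝ => φ p.1 p.2) (t x : ℝ) :
    HasDerivAt (fun r => φ r x) (fderiv ℝ (fun p : ℝ × ℝ => φ p.1 p.2) (t, x) (1, 0)) t :=
  ((hφ.differentiable hn (t, x)).hasFDerivAt).comp_hasDerivAt (f := fun r => (r, x)) t
    ((hasDerivAt_id t).prodMk (hasDerivAt_const t x))

theorem hasDerivAt_right {n : WithTop ℕ∞} (hn : n ≠ 0) {φ : ℝ → ℝ → ℝ}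
    (hφ : ContDiff ℝ n fun p : ℝ × ℝ => φ p.1 p.2) (t x : ℝ) :
    HasDerivAt (φ t) (fderiv ℝ (fun p : ℝ × ℝ => φ p.1 p.2) (t, x) (0, 1)) x :=
  ((hφ.differentiable hn (t, x)).hasFDerivAt).comp_hasDerivAt (f := fun r => (t, r)) x
    ((hasDerivAt_const x t).prodMk (hasDerivAt_id x))

theorem contDiff_deriv_left {n : ℕ} {φ : ℝ → ℝ → ℝ}
    (hφ : ContDiff ℝ (n + 1 : ℕ) fun p : ℝ × ℝ => φ p.1 p.2) :
    ContDiff ℝ n fun p : ℝ × ℝ => deriv (fun r => φ r p.2) p.1 := by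
  have : (fun p : ℝ × ℝ => deriv (fun r => φ r p.2) p.1) =
      fun p => fderiv ℝ (fun p : ℝ × ℝ => φ p.1 p.2) p (1, 0) :=
    funext fun p => (hasDerivAt_left (by simp) hφ p.1 p.2).deriv
  rw [this]
  exact (hφ.fderiv_right (m := n) (by norm_cast)).clm_apply contDiff_const

theorem contDiff_deriv_right {n : ℕ} {φ : ℝ → ℝ → ℝ}
    (hφ : ContDiff ℝ (n + 1 : ℕ) fun p : ℝ × ℝ => φ p.1 p.2) :
    ContDiff ℝ n fun p : ℝ × ℝ => deriv (φ p.1) p.2 := by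
  have : (fun p : ℝ × ℝ => deriv (φ p.1) p.2) =
      fun p => fderiv ℝ (fun p : ℝ × ℝ => φ p.1 p.2) p (0, 1) :=
    funext fun p => (hasDerivAt_right (by simp) hφ p.1 p.2).deriv
  rw [this]
  exact (hφ.fderiv_right (m := n) (by norm_cast)).clm_apply contDiff_const

theorem continuous_iteratedDeriv_right {φ : ℝ → ℝ → ℝ}
    (hφ : ContDiff ℝ 3 fun p : ℝ × ℝ => φ p.1 p.2) :
    Continuous fun p : ℝ × ℝ => iteratedDeriv 3 (φ p.1) p.2 := by
  have h1 := contDiff_deriv_right (n := 2) (φ := φ) (by exact_mod_cast hφ)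
  have h2 := contDiff_deriv_right (n := 1) (φ := fun t => deriv (φ t)) h1
  have h3 := contDiff_deriv_right (n := 0) (φ := fun t => deriv (deriv (φ t))) h2
  simpa only [iteratedDeriv_eq_iterate, Function.iterate_succ, Function.iterate_zero,
    Function.comp_apply, id_eq] using h3.continuous

theorem contDiff_slice_right {n : WithTop ℕ∞} {φ : ℝ → ℝ → ℝ}
    (hφ : ContDiff ℝ n fun p : ℝ × ℝ => φ p.1 p.2) (t : ℝ) : ContDiff ℝ n (φ t) :=
  hφ.comp (contDiff_const.prodMk contDiff_id : ContDiff ℝ n fun x : ℝ => (t, x))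

theorem hasDerivAt_integral_mul (L : ℝ) {φ : ℝ → ℝ → ℝ}
    (hφ : ContDiff ℝ 1 fun p : ℝ × ℝ => φ p.1 p.2) {a : ℝ → ℝ} (ha : Continuous a) (t : ℝ) :
    HasDerivAt (fun t => ∫ x in Ioo 0 L, φ t x * a x)
      (∫ x in Ioo 0 L, deriv (fun r => φ r x) t * a x) t := by
  have hd : Continuous fun p : ℝ × ℝ => deriv (fun r => φ r p.2) p.1 :=
    (contDiff_deriv_left (n := 0) (by simpa using hφ)).continuous
  have hda : Continuous fun p : ℝ × ℝ => deriv (fun r => φ r p.2) p.1 * a p.2 := by fun_prop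
  have hφt : ∀ t, Continuous (φ t) := fun t => (contDiff_slice_right hφ t).continuous
  -- A constant dominates the derivative for times near `t`, by compactness, and is integrable
  -- because `(0,L)` has finite measure.
  obtain ⟨C, hC⟩ := (isCompact_Icc.prod isCompact_Icc).exists_bound_of_continuousOn
    (s := Icc (t - 1) (t + 1) ×ˢ Icc (0 : ℝ) L) hda.continuousOn
  refine (hasDerivAt_integral_of_dominated_loc_of_deriv_le (𝕜 := ℝ) (E := ℝ)
    (F := fun r x => φ r x * a x) (F' := fun r x => deriv (fun r => φ r x) r * a x) (s := Ioo (t - 1) (t + 1))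
    (bound := fun _ => C) (Ioo_mem_nhds (by linarith) (by linarith)) ?_ ?_ ?_ ?_ ?_ ?_).2
  · exact Filter.Eventually.of_forall fun r => ((hφt r).mul ha).aestronglyMeasurable
  · exact ((hφt t).mul ha).integrableOn_Icc.mono_set Ioo_subset_Icc_self
  · exact (hda.comp (by fun_prop : Continuous fun x => (t, x))).aestronglyMeasurable
  · filter_upwards [ae_restrict_mem measurableSet_Ioo] with x hx r hr
    exact hC (r, x) ⟨Ioo_subset_Icc_self hr, Ioo_subset_Icc_self hx⟩
  · exact integrable_const _
  · refine Filter.Eventually.of_forall fun x r _ => ?_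
    exact ((hasDerivAt_left one_ne_zero hφ r x).differentiableAt.hasDerivAt).mul_const _

theorem continuous_integral_mul (L : ℝ) {φ : ℝ → ℝ → ℝ}
    (hφ : Continuous fun p : ℝ × ℝ => φ p.1 p.2) {a : ℝ → ℝ} (ha : Continuous a) :
    Continuous fun t => ∫ x in Ioo 0 L, φ t x * a x := by
  have h : ∀ t, ∫ x in Ioo 0 L, φ t x * a x = inner ℝ (toL2 L (φ t)) (toL2 L a) := fun t =>
    (inner_toL2_toL2 L (hφ.comp (by fun_prop : Continuous fun x => (t, x))) ha).symm
  simp only [h]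
  exact (continuous_toL2 L hφ).inner continuous_const

/-- Gives the `C³` regularity in time of the coefficients of a projected test function. Only
continuity of `a` matters, since all derivatives fall on `φ`. -/
theorem contDiff_integral_mul (L : ℝ) (n : ℕ) {φ : ℝ → ℝ → ℝ}
    (hφ : ContDiff ℝ n fun p : ℝ × ℝ => φ p.1 p.2) {a : ℝ → ℝ} (ha : Continuous a) :
    ContDiff ℝ n fun t => ∫ x in Ioo 0 L, φ t x * a x := by
  induction n generalizing φ with
  | zero =>
    simp only [Nat.cast_zero, contDiff_zero] at hφ ⊢
    exact continuous_integral_mul L hφ ha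
  | succ n ih =>
    have h1 := hasDerivAt_integral_mul L (hφ.of_le (by norm_cast; omega)) ha
    push_cast
    rw [contDiff_succ_iff_deriv]
    refine ⟨fun t => (h1 t).differentiableAt, by simp, ?_⟩
    rw [funext fun t => (h1 t).deriv]
    exact ih (φ := fun t x => deriv (fun r => φ r x) t) (contDiff_deriv_left hφ)

/-! ### Integration by parts -/

theorem hasDerivAt_iteratedDeriv {φ : ℝ → ℝ} {m : ℕ} (hφ : ContDiff ℝ (m + 1 : ℕ) φ) (x : ℝ) :
    HasDerivAt (iteratedDeriv m φ) (iteratedDeriv (m + 1) φ x) x := by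
  have := (hφ.differentiable_iteratedDeriv m (by norm_cast; omega) x).hasDerivAt
  rwa [← iteratedDeriv_succ] at this

/-- The operator `φ ↦ φ' + φ'''`. -/
def airy (φ : ℝ → ℝ) (x : ℝ) : ℝ := deriv φ x + iteratedDeriv 3 φ x

theorem continuous_airy {φ : ℝ → ℝ} (hφ : ContDiff ℝ 3 φ) : Continuous (airy φ) :=
  (hφ.continuous_deriv (by norm_num)).add (hφ.continuous_iteratedDeriv 3 le_rfl)

/-- The boundary conditions `φ(0) = φ(L) = φ'(0) = 0`. -/
structure LeftClamped (L : ℝ) (φ : ℝ → ℝ) : Prop where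
  left : φ 0 = 0
  right : φ L = 0
  deriv_left : deriv φ 0 = 0

/-- The sum of the two integrands is the derivative of `φa + φ''a - φ'a' + φa''`. The boundary
conditions common to both functions kill every boundary term except `φ'(L)a'(L)`, which is where
`a'(L) = 0` enters. -/
theorem integral_airy_mul {L : ℝ} (hL : 0 < L) {φ a : ℝ → ℝ} (hφ : ContDiff ℝ 3 φ)
    (ha : ContDiff ℝ 3 a) (bφ : LeftClamped L φ) (ba : LeftClamped L a) (haL : deriv a L = 0) :
    ∫ x in Ioo 0 L, airy φ x * a x = -∫ x in Ioo 0 L, φ x * airy a x := by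
  have key : ∀ {f : ℝ → ℝ}, ContDiff ℝ 3 f → ∀ x, HasDerivAt f (deriv f x) x ∧
      HasDerivAt (deriv f) (iteratedDeriv 2 f x) x ∧
      HasDerivAt (iteratedDeriv 2 f) (iteratedDeriv 3 f x) x := by
    intro f hf x
    refine ⟨(hf.differentiable (by norm_num) x).hasDerivAt, ?_, ?_⟩
    · simpa [iteratedDeriv_one] using
        hasDerivAt_iteratedDeriv (m := 1) (hf.of_le (by norm_num)) x
    · exact hasDerivAt_iteratedDeriv (m := 2) (by exact_mod_cast hf) x
  have hc1 : Continuous fun x => airy φ x * a x := (continuous_airy hφ).mul ha.continuous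
  have hc2 : Continuous fun x => φ x * airy a x := hφ.continuous.mul (continuous_airy ha)
  have hF := intervalIntegral.integral_eq_sub_of_hasDerivAt (a := 0) (b := L)
    (E := ℝ) (f := fun x => φ x * a x + iteratedDeriv 2 φ x * a x - deriv φ x * deriv a x
      + φ x * iteratedDeriv 2 a x)
    (f' := fun x => airy φ x * a x + φ x * airy a x)
    (fun x _ => by
      obtain ⟨f0, f1, f2⟩ := key hφ x
      obtain ⟨a0, a1, a2⟩ := key ha x
      refine ((((f0.mul a0).add (f2.mul a0)).sub (f1.mul a1)).add (f0.mul a2)).congr_deriv ?_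
      simp only [airy]
      ring)
    ((hc1.add hc2).intervalIntegrable _ _)
  rw [intervalIntegral.integral_add (hc1.intervalIntegrable _ _) (hc2.intervalIntegrable _ _),
    bφ.left, bφ.right, bφ.deriv_left, ba.left, ba.right, haL] at hF
  rw [← integral_Ioc_eq_integral_Ioo, ← integral_Ioc_eq_integral_Ioo,
    ← intervalIntegral.integral_of_le hL.le, ← intervalIntegral.integral_of_le hL.le]
  linarith

/-! ### Smooth representatives of the elements of `M` -/

theorem iteratedDeriv_clm_comp {f : ℝ → ℂ} (ℓ : ℂ →L[ℝ] ℝ) (hf : ContDiff ℝ ∞ f) (n : ℕ) :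
    iteratedDeriv n (fun x => ℓ (f x)) = fun x => ℓ (iteratedDeriv n f x) := by
  induction n with
  | zero => simp
  | succ n ih =>
    rw [iteratedDeriv_succ, ih, iteratedDeriv_succ]
    funext x
    have := (hf.differentiable_iteratedDeriv n (WithTop.coe_lt_coe.2 (ENat.natCast_lt_top n))
      x).hasDerivAt
    exact (ℓ.hasFDerivAt.comp_hasDerivAt x this).deriv

theorem deriv_clm_comp {f : ℝ → ℂ} (ℓ : ℂ →L[ℝ] ℝ) (hf : ContDiff ℝ ∞ f) :
    deriv (fun x => ℓ (f x)) = fun x => ℓ (deriv f x) := by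
  simpa only [iteratedDeriv_one] using iteratedDeriv_clm_comp ℓ hf 1

/-- `a` is a `C³` representative of an element of `L²(0,L)` that vanishes to second order at both
ends. -/
structure IsClampedRep {L : ℝ} (m : L2 L) (a : ℝ → ℝ) : Prop where
  contDiff : ContDiff ℝ 3 a
  clamped : LeftClamped L a
  deriv_right : deriv a L = 0
  toL2_eq : toL2 L a = m

theorem IsMode.isClampedRep {L w : ℝ} {φ : ℝ → ℂ} (hφ : IsMode L w φ) (ℓ : ℂ →L[ℝ] ℝ) {m : L2 L}
    (hm : (m : ℝ → ℝ) =ᵐ[volume.restrict (Ioo (0 : ℝ) L)] fun x => ℓ (φ x)) :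
    IsClampedRep m fun x => ℓ (φ x) where
  contDiff := ℓ.contDiff.comp (by exact_mod_cast contDiff_infty.1 hφ.smooth 3)
  clamped := ⟨by simp [hφ.left], by simp [hφ.right], by
    simp [deriv_clm_comp ℓ hφ.smooth, hφ.deriv_left]⟩
  deriv_right := by simp [deriv_clm_comp ℓ hφ.smooth, hφ.deriv_right]
  toL2_eq := toL2_eq_of_ae (ℓ.continuous.comp hφ.smooth.continuous) hm

/-- Since `ℓ` is only real linear, it commutes with derivatives but the factor `iw` has to stay
inside it. -/
theorem IsMode.airy_clm_comp {L w : ℝ} {φ : ℝ → ℂ} (hφ : IsMode L w φ) (ℓ : ℂ →L[ℝ] ℝ) :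
    EqOn (airy fun x => ℓ (φ x)) (fun x => ℓ (Complex.I * w * φ x)) (Ioo 0 L) := by
  intro x hx
  simp only [airy, deriv_clm_comp ℓ hφ.smooth, iteratedDeriv_clm_comp ℓ hφ.smooth]
  rw [← map_add]
  congr 1
  linear_combination hφ.ode x (Ioo_subset_Icc_self hx)

theorem IsMode.toL2_re_mem {L w : ℝ} {φ : ℝ → ℂ} (hφ : IsMode L w φ) :
    toL2 L (fun x => (φ x).re) ∈ modeParts L w :=
  ⟨φ, hφ, Or.inl (coeFn_toL2 L (Complex.continuous_re.comp hφ.smooth.continuous))⟩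

theorem IsMode.toL2_im_mem {L w : ℝ} {φ : ℝ → ℂ} (hφ : IsMode L w φ) :
    toL2 L (fun x => (φ x).im) ∈ modeParts L w :=
  ⟨φ, hφ, Or.inr (coeFn_toL2 L (Complex.continuous_im.comp hφ.smooth.continuous))⟩

/-- Multiplication by `iw` sends the real part to `-w` times the imaginary part and the imaginary
part to `w` times the real part, so the span of the parts is invariant. -/
theorem exists_isClampedRep_of_mem_modeParts {L w : ℝ} {m : L2 L} (hm : m ∈ modeParts L w) :
    ∃ a, IsClampedRep m a ∧ toL2 L (airy a) ∈ Submodule.span ℝ (modeParts L w) := by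
  obtain ⟨φ, hφ, h | h⟩ := hm
  · have hrep := hφ.isClampedRep Complex.reCLM h
    refine ⟨_, hrep, ?_⟩
    have hc : Continuous fun x => (φ x).im := Complex.continuous_im.comp hφ.smooth.continuous
    have he : toL2 L (airy fun x => Complex.reCLM (φ x)) =
        (-w) • toL2 L (fun x => (φ x).im) := by
      rw [← toL2_const_mul L _ hc]
      refine toL2_congr (continuous_airy hrep.contDiff) (hc.const_mul _) fun x hx => ?_
      rw [hφ.airy_clm_comp _ hx]
      simp
    rw [he]
    exact Submodule.smul_mem _ _ (Submodule.subset_span hφ.toL2_im_mem)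
  · have hrep := hφ.isClampedRep Complex.imCLM h
    refine ⟨_, hrep, ?_⟩
    have hc : Continuous fun x => (φ x).re := Complex.continuous_re.comp hφ.smooth.continuous
    have he : toL2 L (airy fun x => Complex.imCLM (φ x)) =
        w • toL2 L (fun x => (φ x).re) := by
      rw [← toL2_const_mul L _ hc]
      refine toL2_congr (continuous_airy hrep.contDiff) (hc.const_mul _) fun x hx => ?_
      rw [hφ.airy_clm_comp _ hx]
      simp
    rw [he]
    exact Submodule.smul_mem _ _ (Submodule.subset_span hφ.toL2_re_mem)

theorem airy_add {a b : ℝ → ℝ} (ha : ContDiff ℝ 3 a) (hb : ContDiff ℝ 3 b) :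
    airy (fun x => a x + b x) = fun x => airy a x + airy b x := by
  funext x
  have h1 : deriv (fun x => a x + b x) x = deriv a x + deriv b x :=
    deriv_fun_add (ha.differentiable (by norm_num) x) (hb.differentiable (by norm_num) x)
  have h3 : iteratedDeriv 3 (fun x => a x + b x) x = iteratedDeriv 3 a x + iteratedDeriv 3 b x :=
    iteratedDeriv_fun_add ha.contDiffAt hb.contDiffAt
  simp only [airy, h1, h3]
  ring

theorem airy_const_mul (c : ℝ) {a : ℝ → ℝ} (ha : ContDiff ℝ 3 a) :
    airy (fun x => c * a x) = fun x => c * airy a x := by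
  funext x
  have h1 : deriv (fun x => c * a x) x = c * deriv a x :=
    deriv_const_mul c (ha.differentiable (by norm_num) x)
  have h3 : iteratedDeriv 3 (fun x => c * a x) x = c * iteratedDeriv 3 a x :=
    iteratedDeriv_const_mul_field c a
  simp only [airy, h1, h3]
  ring

theorem airy_zero : airy (fun _ => 0) = fun _ => 0 := by
  simpa using airy_const_mul 0 (a := fun _ => (0 : ℝ)) contDiff_const

/-- The elements of `M` have `C³` representatives vanishing to second order at both ends, and `M`
is invariant under `∂ₓ + ∂ₓ³`. -/
theorem exists_isClampedRep {L : ℝ} {m : L2 L} (hm : m ∈ M L) :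
    ∃ a, IsClampedRep m a ∧ toL2 L (airy a) ∈ M L := by
  induction hm using Submodule.span_induction with
  | mem m hm =>
    simp only [mem_iUnion] at hm
    obtain ⟨p, hp, hm⟩ := hm
    obtain ⟨a, ha, h⟩ := exists_isClampedRep_of_mem_modeParts hm
    exact ⟨a, ha, Submodule.span_mono
      (subset_biUnion_of_mem (u := fun p : ℕ × ℕ => modeParts L (freq p.1 p.2)) hp) h⟩
  | zero =>
    have h0 : toL2 L (fun _ => 0) = 0 := by
      simpa using toL2_const_mul L 0 (g := fun _ => 0) continuous_const
    refine ⟨fun _ => 0, ⟨contDiff_const, ⟨rfl, rfl, by simp⟩, by simp, h0⟩, ?_⟩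
    rw [airy_zero, h0]
    exact zero_mem _
  | add m n _ _ hm hn =>
    obtain ⟨a, ha, ham⟩ := hm
    obtain ⟨b, hb, hbm⟩ := hn
    have hd : ∀ x, deriv (fun x => a x + b x) x = deriv a x + deriv b x := fun x =>
      deriv_fun_add (ha.contDiff.differentiable (by norm_num) x)
        (hb.contDiff.differentiable (by norm_num) x)
    refine ⟨fun x => a x + b x, ⟨ha.contDiff.add hb.contDiff, ⟨?_, ?_, ?_⟩, ?_, ?_⟩, ?_⟩
    · simp [ha.clamped.left, hb.clamped.left]
    · simp [ha.clamped.right, hb.clamped.right]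
    · simp [hd, ha.clamped.deriv_left, hb.clamped.deriv_left]
    · simp [hd, ha.deriv_right, hb.deriv_right]
    · rw [toL2_add L ha.contDiff.continuous hb.contDiff.continuous, ha.toL2_eq, hb.toL2_eq]
    · rw [airy_add ha.contDiff hb.contDiff,
        toL2_add L (continuous_airy ha.contDiff) (continuous_airy hb.contDiff)]
      exact add_mem ham hbm
  | smul c m _ hm =>
    obtain ⟨a, ha, ham⟩ := hm
    have hd : ∀ x, deriv (fun x => c * a x) x = c * deriv a x := fun x =>
      deriv_const_mul c (ha.contDiff.differentiable (by norm_num) x)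
    refine ⟨fun x => c * a x, ⟨contDiff_const.mul ha.contDiff, ⟨?_, ?_, ?_⟩, ?_, ?_⟩, ?_⟩
    · simp [ha.clamped.left]
    · simp [ha.clamped.right]
    · simp [hd, ha.clamped.deriv_left]
    · simp [hd, ha.deriv_right]
    · rw [toL2_const_mul L _ ha.contDiff.continuous, ha.toL2_eq]
    · rw [airy_const_mul _ ha.contDiff, toL2_const_mul L _ (continuous_airy ha.contDiff)]
      exact Submodule.smul_mem _ _ ham

/-! ### Weak derivatives -/

/-- The fundamental lemma of the calculus of variations. It yields both the uniqueness of weak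
derivatives and the identification of the initial datum. -/
theorem eq_zero_of_forall_integral_eq_zero {L : ℝ} {f : L2 L}
    (h : ∀ ψ : ℝ → ℝ, ContDiff ℝ ∞ ψ → HasCompactSupport ψ → tsupport ψ ⊆ Ioo 0 L →
      ∫ x in Ioo 0 L, f x * ψ x = 0) : f = 0 := by
  have hloc : LocallyIntegrableOn (f : ℝ → ℝ) (Ioo 0 L) volume :=
    IntegrableOn.locallyIntegrableOn ((Lp.memLp f).integrable (by norm_num))
  have hz := isOpen_Ioo.ae_eq_zero_of_integral_contDiff_smul_eq_zero hloc fun ψ h1 h2 h3 => by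
    refine Eq.trans ?_ (h ψ h1 h2 h3)
    rw [setIntegral_eq_integral_of_forall_compl_eq_zero]
    · simp only [smul_eq_mul, mul_comm]
    · intro x hx
      rw [image_eq_zero_of_notMem_tsupport fun hx' => hx (h3 hx'), mul_zero]
  apply Lp.ext
  filter_upwards [ae_restrict_of_ae hz, ae_restrict_mem measurableSet_Ioo,
    Lp.coeFn_zero ℝ 2 (volume.restrict (Ioo (0 : ℝ) L))] with x h1 h2 h3
  rw [h1 h2, h3, Pi.zero_apply]

theorem isWeakDeriv_iff {L : ℝ} {f g : L2 L} : IsWeakDeriv f g ↔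
    ∀ ψ : ℝ → ℝ, ContDiff ℝ ∞ ψ → HasCompactSupport ψ → tsupport ψ ⊆ Ioo 0 L →
      inner ℝ (toL2 L (deriv ψ)) f = -inner ℝ (toL2 L ψ) g := by
  refine forall_congr' fun ψ => forall_congr' fun h => ?_
  rw [integral_mul_eq_inner' (h.continuous_deriv (by simp)), integral_mul_eq_inner' h.continuous]

theorem IsWeakDeriv.unique {L : ℝ} {f g g' : L2 L} (hg : IsWeakDeriv f g)
    (hg' : IsWeakDeriv f g') : g = g' := by
  rw [← sub_eq_zero]
  refine eq_zero_of_forall_integral_eq_zero fun ψ h1 h2 h3 => ?_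
  rw [integral_mul_eq_inner' h1.continuous, inner_sub_right]
  have e := isWeakDeriv_iff.1 hg ψ h1 h2 h3
  have e' := isWeakDeriv_iff.1 hg' ψ h1 h2 h3
  linarith

/-- Uniqueness makes the choice inside `weakDeriv` harmless, so that it is linear on `H¹`. -/
theorem IsWeakDeriv.weakDeriv_eq {L : ℝ} {f g : L2 L} (hg : IsWeakDeriv f g) :
    weakDeriv f = g := by
  have h : InH1 f := ⟨g, hg⟩
  rw [weakDeriv, dif_pos h]
  exact h.choose_spec.unique hg

theorem InH1.isWeakDeriv {L : ℝ} {f : L2 L} (h : InH1 f) : IsWeakDeriv f (weakDeriv f) := by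
  rw [weakDeriv, dif_pos h]
  exact h.choose_spec

theorem IsWeakDeriv.add {L : ℝ} {f f' g g' : L2 L} (hf : IsWeakDeriv f f')
    (hg : IsWeakDeriv g g') : IsWeakDeriv (f + g) (f' + g') := by
  rw [isWeakDeriv_iff] at *
  intro ψ h1 h2 h3
  rw [inner_add_right, inner_add_right, hf ψ h1 h2 h3, hg ψ h1 h2 h3]
  ring

theorem IsWeakDeriv.smul {L : ℝ} {f f' : L2 L} (hf : IsWeakDeriv f f') (c : ℝ) :
    IsWeakDeriv (c • f) (c • f') := by
  rw [isWeakDeriv_iff] at *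
  intro ψ h1 h2 h3
  rw [inner_smul_right, inner_smul_right, hf ψ h1 h2 h3]
  ring

theorem IsWeakDeriv.sub {L : ℝ} {f f' g g' : L2 L} (hf : IsWeakDeriv f f')
    (hg : IsWeakDeriv g g') : IsWeakDeriv (f - g) (f' - g') := by
  simpa [sub_eq_add_neg] using hf.add (hg.smul (-1))

theorem isWeakDeriv_toL2 {L : ℝ} (hL : 0 < L) {a : ℝ → ℝ} (ha : ContDiff ℝ 1 a) :
    IsWeakDeriv (toL2 L a) (toL2 L (deriv a)) := by
  have ha' : Continuous (deriv a) := ha.continuous_deriv le_rfl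
  rw [isWeakDeriv_iff]
  intro ψ h1 _ h3
  have hψ' : Continuous (deriv ψ) := h1.continuous_deriv (by simp)
  have hψ0 : ψ 0 = 0 := image_eq_zero_of_notMem_tsupport fun h => (h3 h).1.false
  have hψL : ψ L = 0 := image_eq_zero_of_notMem_tsupport fun h => (h3 h).2.false
  rw [inner_toL2_toL2 L hψ' ha.continuous, inner_toL2_toL2 L h1.continuous ha',
    ← integral_Ioc_eq_integral_Ioo, ← integral_Ioc_eq_integral_Ioo,
    ← intervalIntegral.integral_of_le hL.le, ← intervalIntegral.integral_of_le hL.le]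
  have hi1 : IntervalIntegrable (fun x => deriv ψ x * a x) volume 0 L :=
    (hψ'.mul ha.continuous).intervalIntegrable 0 L
  have hi2 : IntervalIntegrable (fun x => ψ x * deriv a x) volume 0 L :=
    (h1.continuous.mul ha').intervalIntegrable 0 L
  have hF := intervalIntegral.integral_eq_sub_of_hasDerivAt (a := 0) (b := L)
    (E := ℝ) (f := fun x => ψ x * a x) (f' := fun x => deriv ψ x * a x + ψ x * deriv a x)
    (fun x _ => (h1.differentiable (by simp) x).hasDerivAt.mul
      (ha.differentiable one_ne_zero x).hasDerivAt) (hi1.add hi2)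
  rw [intervalIntegral.integral_add hi1 hi2, hψ0, hψL] at hF
  linarith

theorem inH1_of_mem_M {L : ℝ} (hL : 0 < L) {m : L2 L} (hm : m ∈ M L) : InH1 m := by
  obtain ⟨a, ha, -⟩ := exists_isClampedRep hm
  have := isWeakDeriv_toL2 hL (ha.contDiff.of_le (by norm_num : (1 : WithTop ℕ∞) ≤ 3))
  rw [ha.toL2_eq] at this
  exact ⟨_, this⟩

/-- The weak derivative as a linear map on `M`. -/
def weakDerivM {L : ℝ} (hL : 0 < L) : M L →ₗ[ℝ] L2 L where
  toFun m := weakDeriv (m : L2 L)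
  map_add' m n := ((inH1_of_mem_M hL m.2).isWeakDeriv.add
    (inH1_of_mem_M hL n.2).isWeakDeriv).weakDeriv_eq
  map_smul' c m := ((inH1_of_mem_M hL m.2).isWeakDeriv.smul c).weakDeriv_eq

theorem PM_mem {L : ℝ} (f : L2 L) : PM L f ∈ M L := Submodule.starProjection_apply_mem _ f

theorem PH_add_PM {L : ℝ} (f : L2 L) : PH L f + PM L f = f := by
  have := Submodule.starProjection_add_starProjection_orthogonal (K := M L) f
  rw [add_comm]
  exact this

theorem PH_eq {L : ℝ} (f : L2 L) : PH L f = f - PM L f := eq_sub_of_add_eq (PH_add_PM f)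

theorem inner_PM {L : ℝ} (f g : L2 L) : inner ℝ (PM L f) g = inner ℝ f (PM L g) :=
  Submodule.inner_starProjection_left_eq_right (M L) f g

/-- On the finite-dimensional space `M` the weak derivative is linear, hence continuous. The
derivative of the projected curve is thus continuous in time for the `L²` norm, and bounded on the
compact interval. -/
theorem MemB.PM {L : ℝ} (hL : 0 < L) {s T : ℝ} {y : ℝ → L2 L} (hy : MemB s T y) :
    MemB s T fun t => PM L (y t) where
  continuousOn := (KdV.PM L).continuous.comp_continuousOn hy.continuousOn
  inH1 := Filter.Eventually.of_forall fun t => inH1_of_mem_M hL (PM_mem _)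
  memLp_deriv := by
    have hc : ContinuousOn (fun t => weakDeriv (KdV.PM L (y t))) (Icc s T) :=
      (((weakDerivM hL).continuous_of_finiteDimensional).comp
        (M L).orthogonalProjectionOnto.continuous).comp_continuousOn hy.continuousOn
    obtain ⟨C, hC⟩ := isCompact_Icc.exists_bound_of_continuousOn hc
    refine MemLp.of_bound (hc.aestronglyMeasurable measurableSet_Icc) C ?_
    filter_upwards [ae_restrict_mem measurableSet_Icc] with t ht
    exact hC t ht

theorem MemB.sub {L : ℝ} {s T : ℝ} {y z : ℝ → L2 L} (hy : MemB s T y) (hz : MemB s T z) :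
    MemB s T fun t => y t - z t where
  continuousOn := hy.continuousOn.sub hz.continuousOn
  inH1 := by
    filter_upwards [hy.inH1, hz.inH1] with t h1 h2
    exact ⟨_, h1.isWeakDeriv.sub h2.isWeakDeriv⟩
  memLp_deriv := by
    refine (hy.memLp_deriv.sub hz.memLp_deriv).ae_eq ?_
    filter_upwards [hy.inH1, hz.inH1] with t h1 h2
    exact (h1.isWeakDeriv.sub h2.isWeakDeriv).weakDeriv_eq.symm

theorem MemB.mono {L : ℝ} {s T T₁ T₂ : ℝ} {y : ℝ → L2 L} (hy : MemB s T y)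
    (h : Icc T₁ T₂ ⊆ Icc s T) : MemB T₁ T₂ y where
  continuousOn := hy.continuousOn.mono h
  inH1 := ae_restrict_of_ae_restrict_of_subset h hy.inH1
  memLp_deriv := hy.memLp_deriv.mono_measure (Measure.restrict_mono_set _ h)

/-! ### The weak formulation in terms of inner products -/

/-- The adjoint operator `φ ↦ φ_t + φ_x + φ_xxx`. -/
def adjointOp (φ : ℝ → ℝ → ℝ) (t x : ℝ) : ℝ :=
  deriv (fun r => φ r x) t + deriv (φ t) x + iteratedDeriv 3 (φ t) x

theorem continuous_adjointOp {φ : ℝ → ℝ → ℝ} (hφ : ContDiff ℝ 3 fun p : ℝ × ℝ => φ p.1 p.2) :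
    Continuous fun p : ℝ × ℝ => adjointOp φ p.1 p.2 :=
  ((contDiff_deriv_left (n := 2) (φ := φ) (by exact_mod_cast hφ)).continuous.add
    (contDiff_deriv_right (n := 2) (φ := φ) (by exact_mod_cast hφ)).continuous).add
    (continuous_iteratedDeriv_right hφ)

theorem continuous_slice {φ : ℝ → ℝ → ℝ} (hφ : Continuous fun p : ℝ × ℝ => φ p.1 p.2) (t : ℝ) :
    Continuous (φ t) :=
  hφ.comp (by fun_prop : Continuous fun x => (t, x))

theorem continuous_deriv_trace {φ : ℝ → ℝ → ℝ}
    (hφ : ContDiff ℝ 3 fun p : ℝ × ℝ => φ p.1 p.2) (L : ℝ) :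
    Continuous fun t => deriv (φ t) L :=
  (contDiff_deriv_right (n := 2) (φ := φ) (by exact_mod_cast hφ)).continuous.comp
    (by fun_prop : Continuous fun t => (t, L))

/-- The time density of the weak formulation. -/
def density {L : ℝ} (f : ℝ → L2 L) (h : ℝ → ℝ) (y : ℝ → L2 L) (φ : ℝ → ℝ → ℝ) (t : ℝ) : ℝ :=
  inner ℝ (toL2 L (adjointOp φ t)) (y t) + h t * deriv (φ t) L + inner ℝ (toL2 L (φ t)) (f t)

/-- The weak formulation on `[T₁,τ]` for a single test function. -/
def WeakIdentity {L : ℝ} (T₁ τ : ℝ) (f : ℝ → L2 L) (h : ℝ → ℝ) (y₀ : L2 L) (y : ℝ → L2 L)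
    (φ : ℝ → ℝ → ℝ) : Prop :=
  inner ℝ (toL2 L (φ τ)) (y τ) = inner ℝ (toL2 L (φ T₁)) y₀ + ∫ t in T₁..τ, density f h y φ t

theorem integrableOn_inner {E : Type*} [NormedAddCommGroup E] [InnerProductSpace ℝ E] {a b : ℝ}
    {G y : ℝ → E} (hG : Continuous G) (hy : IntegrableOn y (Icc a b)) :
    IntegrableOn (fun t => inner ℝ (G t) (y t)) (Icc a b) := by
  obtain ⟨C, hC⟩ := isCompact_Icc.exists_bound_of_continuousOn (s := Icc a b) hG.continuousOn
  refine Integrable.mono' (hy.norm.const_mul C)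
    ((hG.continuousOn.aestronglyMeasurable measurableSet_Icc).inner hy.aestronglyMeasurable) ?_
  filter_upwards [ae_restrict_mem measurableSet_Icc] with t ht
  exact (norm_inner_le_norm _ _).trans (mul_le_mul_of_nonneg_right (hC t ht) (norm_nonneg _))

theorem integrableOn_mul {a b : ℝ} {c h : ℝ → ℝ} (hc : Continuous c)
    (hh : MemLp h 2 (volume.restrict (Icc a b))) :
    IntegrableOn (fun t => h t * c t) (Icc a b) := by
  simpa using integrableOn_inner (E := ℝ) hc (y := h) (hh.integrable (by norm_num))

section Data

variable {L T₁ T₂ : ℝ} {f : ℝ → L2 L} {h : ℝ → ℝ} {y : ℝ → L2 L} {φ : ℝ → ℝ → ℝ}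

theorem integrableOn_density (hf : IntegrableOn f (Icc T₁ T₂))
    (hh : MemLp h 2 (volume.restrict (Icc T₁ T₂))) (hy : IntegrableOn y (Icc T₁ T₂))
    (hφ : ContDiff ℝ 3 fun p : ℝ × ℝ => φ p.1 p.2) :
    IntegrableOn (density f h y φ) (Icc T₁ T₂) :=
  ((integrableOn_inner (continuous_toL2 L (continuous_adjointOp hφ)) hy).add
    (integrableOn_mul (continuous_deriv_trace hφ L) hh)).add
    (integrableOn_inner (continuous_toL2 L hφ.continuous) hf)

theorem intervalIntegrable_of_integrableOn_Icc {E : Type*} [NormedAddCommGroup E] {g : ℝ → E}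
    {a b c d : ℝ} (hg : IntegrableOn g (Icc a b)) (hc : c ∈ Icc a b) (hd : d ∈ Icc a b) :
    IntervalIntegrable g volume c d :=
  (hg.mono_set (uIcc_subset_Icc hc hd)).intervalIntegrable

/-- Integrability of each term is what allows the three time integrals to be merged into one. -/
theorem weakIdentity_iff (hf : IntegrableOn f (Icc T₁ T₂))
    (hh : MemLp h 2 (volume.restrict (Icc T₁ T₂))) (hy : IntegrableOn y (Icc T₁ T₂))
    (hφ : ContDiff ℝ 3 fun p : ℝ × ℝ => φ p.1 p.2) {τ : ℝ} (hτ : τ ∈ Icc T₁ T₂) (y₀ : L2 L) :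
    (-(∫ t in T₁..τ, ∫ x in Ioo 0 L,
        (deriv (fun r => φ r x) t + deriv (φ t) x + iteratedDeriv 3 (φ t) x) * y t x)
      - (∫ t in T₁..τ, h t * deriv (φ t) L)
      - (∫ t in T₁..τ, ∫ x in Ioo 0 L, φ t x * f t x)
      + (∫ x in Ioo 0 L, y τ x * φ τ x)
      - (∫ x in Ioo 0 L, y₀ x * φ T₁ x) = 0) ↔ WeakIdentity T₁ τ f h y₀ y φ := by
  have hA := continuous_adjointOp hφ
  have hT₁ : T₁ ∈ Icc T₁ T₂ := left_mem_Icc.2 (hτ.1.trans hτ.2)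
  have i1 := intervalIntegrable_of_integrableOn_Icc
    (integrableOn_inner (continuous_toL2 L hA) hy) hT₁ hτ
  have i2 := intervalIntegrable_of_integrableOn_Icc
    (integrableOn_mul (continuous_deriv_trace hφ L) hh) hT₁ hτ
  have i3 := intervalIntegrable_of_integrableOn_Icc
    (integrableOn_inner (continuous_toL2 L hφ.continuous) hf) hT₁ hτ
  have e1 : ∀ t, ∫ x in Ioo 0 L,
      (deriv (fun r => φ r x) t + deriv (φ t) x + iteratedDeriv 3 (φ t) x) * y t x =
      inner ℝ (toL2 L (adjointOp φ t)) (y t) := fun t =>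
    integral_mul_eq_inner (continuous_slice hA t) (y t)
  have e2 : ∀ t, ∫ x in Ioo 0 L, φ t x * f t x = inner ℝ (toL2 L (φ t)) (f t) := fun t =>
    integral_mul_eq_inner (continuous_slice hφ.continuous t) (f t)
  simp only [e1, e2]
  rw [integral_mul_eq_inner' (continuous_slice hφ.continuous τ),
    integral_mul_eq_inner' (continuous_slice hφ.continuous T₁), WeakIdentity]
  simp only [density]
  rw [intervalIntegral.integral_add (i1.add i2) i3, intervalIntegral.integral_add i1 i2]
  constructor <;> intro <;> linarith

end Data

theorem isLinearSolution_iff {L T₁ T₂ : ℝ} {f : ℝ → L2 L} {h : ℝ → ℝ} {y₀ : L2 L}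
    {y : ℝ → L2 L} : IsLinearSolution T₁ T₂ f h y₀ y ↔
      IntegrableOn f (Icc T₁ T₂) ∧ MemLp h 2 (volume.restrict (Icc T₁ T₂)) ∧
      IntegrableOn y (Icc T₁ T₂) ∧ ∀ᵐ τ ∂(volume.restrict (Icc T₁ T₂)), ∀ φ : ℝ → ℝ → ℝ,
        IsTest L T₁ τ φ → WeakIdentity T₁ τ f h y₀ y φ := by
  constructor
  · rintro ⟨hf, hh, hy, hw⟩
    refine ⟨hf, hh, hy, ?_⟩
    filter_upwards [hw, ae_restrict_mem measurableSet_Icc] with τ h1 h2 φ hφ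
    exact (weakIdentity_iff hf hh hy hφ.contDiff h2 y₀).1 (h1 φ hφ)
  · rintro ⟨hf, hh, hy, hw⟩
    refine ⟨hf, hh, hy, ?_⟩
    filter_upwards [hw, ae_restrict_mem measurableSet_Icc] with τ h1 h2 φ hφ
    exact (weakIdentity_iff hf hh hy hφ.contDiff h2 y₀).2 (h1 φ hφ)

theorem adjointOp_eq (φ : ℝ → ℝ → ℝ) (t : ℝ) :
    adjointOp φ t = fun x => deriv (fun r => φ r x) t + airy (φ t) x := by
  funext x
  simp only [adjointOp, airy]
  ring

theorem toL2_adjointOp (L : ℝ) {φ : ℝ → ℝ → ℝ} (hφ : ContDiff ℝ 3 fun p : ℝ × ℝ => φ p.1 p.2)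
    (t : ℝ) : toL2 L (adjointOp φ t) =
      toL2 L (fun x => deriv (fun r => φ r x) t) + toL2 L (airy (φ t)) := by
  rw [adjointOp_eq, toL2_add L _ (continuous_airy (contDiff_slice_right hφ t))]
  exact continuous_slice (φ := fun t x => deriv (fun r => φ r x) t)
    (contDiff_deriv_left (n := 2) (φ := φ) (by exact_mod_cast hφ)).continuous t

/-! ### Projection of test functions onto `M` -/

theorem inner_toL2_airy {L : ℝ} (hL : 0 < L) {φ a : ℝ → ℝ} {m : L2 L} (hφ : ContDiff ℝ 3 φ)
    (bφ : LeftClamped L φ) (ha : IsClampedRep m a) :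
    inner ℝ (toL2 L (airy φ)) m = -inner ℝ (toL2 L φ) (toL2 L (airy a)) := by
  rw [← ha.toL2_eq, inner_toL2_toL2 L (continuous_airy hφ) ha.contDiff.continuous,
    inner_toL2_toL2 L hφ.continuous (continuous_airy ha.contDiff)]
  exact integral_airy_mul hL hφ ha.contDiff bφ ha.clamped ha.deriv_right

theorem IsTest.leftClamped {L T₁ τ t : ℝ} {φ : ℝ → ℝ → ℝ} (hφ : IsTest L T₁ τ φ)
    (ht : t ∈ Icc T₁ τ) : LeftClamped L (φ t) :=
  ⟨hφ.left t ht, hφ.right t ht, hφ.deriv_left t ht⟩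

theorem airy_sum {ι : Type*} (S : Finset ι) (c : ι → ℝ) {a : ι → ℝ → ℝ}
    (ha : ∀ i, ContDiff ℝ 3 (a i)) :
    airy (fun x => ∑ i ∈ S, c i * a i x) = fun x => ∑ i ∈ S, c i * airy (a i) x := by
  classical
  induction S using Finset.induction_on with
  | empty => simpa using airy_zero
  | insert i S hi ih =>
    simp only [Finset.sum_insert hi]
    rw [airy_add (contDiff_const.mul (ha i))
      (ContDiff.sum fun j _ => contDiff_const.mul (ha j)), ih, airy_const_mul _ (ha i)]

theorem toL2_sum_const_mul (L : ℝ) {ι : Type*} (S : Finset ι) (c : ι → ℝ) {g : ι → ℝ → ℝ}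
    (hg : ∀ i, Continuous (g i)) :
    toL2 L (fun x => ∑ i ∈ S, c i * g i x) = ∑ i ∈ S, c i • toL2 L (g i) := by
  rw [toL2_sum L S fun i => (hg i).const_mul (c i)]
  exact Finset.sum_congr rfl fun i _ => toL2_const_mul L _ (hg i)

theorem PM_eq_sum {L : ℝ} {ι : Type*} [Fintype ι] (e : OrthonormalBasis ι ℝ (M L)) (f : L2 L) :
    PM L f = ∑ i, inner ℝ (e i : L2 L) f • (e i : L2 L) := by
  rw [PM, Submodule.starProjection_apply, e.orthogonalProjectionOnto_apply_eq_sum]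
  simp

/-- The projection of a test function onto `M` is a test function whose normal derivative at `L`
vanishes. Testing with it amounts to projecting the solution. -/
theorem IsTest.exists_projection {L : ℝ} (hL : 0 < L) {T₁ τ : ℝ} {φ : ℝ → ℝ → ℝ}
    (hφ : IsTest L T₁ τ φ) : ∃ ψ : ℝ → ℝ → ℝ, IsTest L T₁ τ ψ ∧
      (∀ t, deriv (ψ t) L = 0) ∧ (∀ t, toL2 L (ψ t) = PM L (toL2 L (φ t))) ∧
      ∀ t ∈ Icc T₁ τ, ∀ z : L2 L,
        inner ℝ (toL2 L (adjointOp ψ t)) z = inner ℝ (toL2 L (adjointOp φ t)) (PM L z) := by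
  let e := stdOrthonormalBasis ℝ (M L)
  choose a ha haM using fun i => exists_isClampedRep (e i).2
  -- The projected test function is `∑ cᵢ(t) aᵢ(x)`, where `aᵢ` is a clamped `C³` representative of
  -- the basis vector `eᵢ` and `cᵢ(t) = ⟨eᵢ, φ(t)⟩`.
  have ha0 : ∀ i, Continuous (a i) := fun i => (ha i).contDiff.continuous
  have hφ3 := hφ.contDiff
  have hφc : ∀ t, Continuous (φ t) := continuous_slice hφ3.continuous
  have hφd := (contDiff_deriv_left (n := 2) (φ := φ) (by exact_mod_cast hφ3)).continuous
  have hφdc := continuous_slice (φ := fun t x => deriv (fun r => φ r x) t) hφd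
  let c : Fin (Module.finrank ℝ (M L)) → ℝ → ℝ := fun i t => ∫ x in Ioo 0 L, φ t x * a i x
  have hc : ∀ i t, c i t = inner ℝ (e i : L2 L) (toL2 L (φ t)) := fun i t => by
    rw [← (ha i).toL2_eq, real_inner_comm, inner_toL2_toL2 L (hφc t) (ha0 i)]
  have hc3 : ∀ i, ContDiff ℝ 3 (c i) := fun i => by
    exact_mod_cast contDiff_integral_mul L 3 (φ := φ) (by exact_mod_cast hφ3) (ha0 i)
  have hc' : ∀ i t, HasDerivAt (c i)
      (inner ℝ (e i : L2 L) (toL2 L fun x => deriv (fun r => φ r x) t)) t := fun i t => by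
    have := hasDerivAt_integral_mul L (hφ3.of_le (by norm_num)) (ha0 i) t
    rwa [← inner_toL2_toL2 L (hφdc t) (ha0 i), (ha i).toL2_eq, real_inner_comm] at this
  let ψ : ℝ → ℝ → ℝ := fun t x => ∑ i, c i t * a i x
  have hψ3 : ContDiff ℝ 3 fun p : ℝ × ℝ => ψ p.1 p.2 :=
    ContDiff.sum fun i _ => ((hc3 i).comp contDiff_fst).mul ((ha i).contDiff.comp contDiff_snd)
  have hψx : ∀ t x, deriv (ψ t) x = ∑ i, c i t * deriv (a i) x := fun t x =>
    (HasDerivAt.fun_sum fun i _ =>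
      (((ha i).contDiff.differentiable (by norm_num) x).hasDerivAt).const_mul (c i t)).deriv
  have hψt : ∀ t x, deriv (fun r => ψ r x) t =
      ∑ i, inner ℝ (e i : L2 L) (toL2 L fun x => deriv (fun r => φ r x) t) * a i x := fun t x =>
    (HasDerivAt.fun_sum fun i _ => (hc' i t).mul_const (a i x)).deriv
  have hsumM : ∀ f : L2 L, toL2 L (fun x => ∑ i, inner ℝ (e i : L2 L) f * a i x) = PM L f :=
    fun f => by
      rw [toL2_sum_const_mul L _ _ ha0, PM_eq_sum e]
      exact Finset.sum_congr rfl fun i _ => by rw [(ha i).toL2_eq]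
  refine ⟨ψ, ⟨hψ3, ?_, ?_, ?_⟩, ?_, ?_, ?_⟩
  · intro t _
    simp [ψ, (ha _).clamped.left]
  · intro t _
    simp [ψ, (ha _).clamped.right]
  · intro t _
    simp [hψx, (ha _).clamped.deriv_left]
  · intro t
    simp [hψx, (ha _).deriv_right]
  · intro t
    rw [← hsumM]
    simp only [ψ, hc]
  · intro t ht z
    -- Both sides expand into double sums over the matrix of `∂ₓ + ∂ₓ³` on `M`. The right side
    -- carries the transposed matrix, with a minus sign from the integration by parts against `φ t`;
    -- antisymmetry makes them agree.
    have hairy : inner ℝ (toL2 L (airy (ψ t))) z = inner ℝ (toL2 L (airy (φ t))) (PM L z) := by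
      -- The expansion in the basis is exact because `M` is invariant.
      have hd : ∀ i, toL2 L (airy (a i)) =
          ∑ j, inner ℝ (e j : L2 L) (toL2 L (airy (a i))) • (e j : L2 L) := fun i => by
        rw [← PM_eq_sum e]
        exact (Submodule.starProjection_eq_self_iff.2 (haM i)).symm
      have hanti : ∀ i j, inner ℝ (e j : L2 L) (toL2 L (airy (a i))) =
          -inner ℝ (e i : L2 L) (toL2 L (airy (a j))) := fun i j => by
        rw [real_inner_comm, inner_toL2_airy hL (ha i).contDiff (ha i).clamped (ha j),
          (ha i).toL2_eq]
      rw [show ψ t = fun x => ∑ i, c i t * a i x from rfl,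
        airy_sum _ _ fun i => (ha i).contDiff, toL2_sum_const_mul L _ _ fun i => continuous_airy (ha i).contDiff,
        PM_eq_sum e z, sum_inner, inner_sum]
      simp only [inner_smul_left, inner_smul_right, RCLike.conj_to_real,
        inner_toL2_airy hL (contDiff_slice_right hφ3 t) (hφ.leftClamped ht) (ha _)]
      have hl : ∀ i, inner ℝ (toL2 L (airy (a i))) z =
          ∑ j, inner ℝ (e j : L2 L) (toL2 L (airy (a i))) * inner ℝ (e j : L2 L) z := fun i => by
        conv_lhs => rw [hd i, sum_inner]
        simp only [inner_smul_left, RCLike.conj_to_real]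
      have hr : ∀ i, inner ℝ (toL2 L (φ t)) (toL2 L (airy (a i))) =
          ∑ j, inner ℝ (e j : L2 L) (toL2 L (airy (a i))) * c j t := fun i => by
        conv_lhs => rw [hd i, inner_sum]
        simp only [inner_smul_right, hc, real_inner_comm]
      simp only [hl, hr, Finset.mul_sum, ← Finset.sum_neg_distrib]
      rw [Finset.sum_comm]
      refine Finset.sum_congr rfl fun i _ => Finset.sum_congr rfl fun j _ => ?_
      rw [hanti j i]
      ring
    -- The time derivative only needs `ψ_t = P_M φ_t` and the self-adjointness of `P_M`.
    rw [toL2_adjointOp L hψ3, toL2_adjointOp L hφ3, inner_add_left, inner_add_left, hairy,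
      ← inner_PM (toL2 L fun x => deriv (fun r => φ r x) t)]
    simp only [hψt, hsumM]

/-! ### Restarting the weak formulation at a later time -/

/-- A smooth function that vanishes on `(-∞,b]` and equals `1` on `[b + 1/(n+1), ∞)`. -/
def cutoff (b : ℝ) (n : ℕ) (t : ℝ) : ℝ := Real.smoothTransition ((n + 1) * (t - b))

theorem contDiff_cutoff (b : ℝ) (n : ℕ) {m : ℕ∞} : ContDiff ℝ m (cutoff b n) :=
  Real.smoothTransition.contDiff.comp (contDiff_const.mul (contDiff_id.sub contDiff_const))

theorem hasDerivAt_cutoff (b : ℝ) (n : ℕ) (t : ℝ) :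
    HasDerivAt (cutoff b n) (deriv (cutoff b n) t) t :=
  ((contDiff_cutoff b n (m := 1)).differentiable one_ne_zero t).hasDerivAt

theorem continuous_deriv_cutoff (b : ℝ) (n : ℕ) : Continuous (deriv (cutoff b n)) :=
  (contDiff_cutoff b n (m := 1)).continuous_deriv le_rfl

theorem cutoff_eq_zero {b t : ℝ} (n : ℕ) (h : t ≤ b) : cutoff b n t = 0 :=
  Real.smoothTransition.zero_of_nonpos
    (mul_nonpos_of_nonneg_of_nonpos (by positivity) (sub_nonpos.2 h))

theorem cutoff_eq_one {b t : ℝ} {n : ℕ} (h : 1 ≤ (n + 1) * (t - b)) : cutoff b n t = 1 :=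
  Real.smoothTransition.one_of_one_le h

theorem eventually_one_le_mul {δ : ℝ} (hδ : 0 < δ) :
    ∀ᶠ n : ℕ in Filter.atTop, 1 ≤ ((n : ℝ) + 1) * δ := by
  filter_upwards [(tendsto_natCast_atTop_atTop (R := ℝ)).eventually_ge_atTop (1 / δ)] with n hn
  rw [div_le_iff₀ hδ] at hn
  nlinarith

theorem monotone_cutoff (b : ℝ) (n : ℕ) : Monotone (cutoff b n) := fun t t' h =>
  Real.smoothTransition.monotone
    (mul_le_mul_of_nonneg_left (sub_le_sub_right h b) (by positivity))

theorem deriv_cutoff_of_lt {b t : ℝ} (n : ℕ) (h : t < b) : deriv (cutoff b n) t = 0 := by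
  have : cutoff b n =ᶠ[nhds t] fun _ => 0 := by
    filter_upwards [Iio_mem_nhds h] with r hr
    exact cutoff_eq_zero n (le_of_lt hr)
  simp [this.deriv_eq]

theorem deriv_cutoff_of_gt {b t δ : ℝ} {n : ℕ} (hδ : 1 ≤ ((n : ℝ) + 1) * δ) (h : b + δ < t) :
    deriv (cutoff b n) t = 0 := by
  have : cutoff b n =ᶠ[nhds t] fun _ => 1 := by
    filter_upwards [Ioi_mem_nhds h] with r hr
    refine cutoff_eq_one (hδ.trans (mul_le_mul_of_nonneg_left ?_ (by positivity)))
    have : b + δ < r := hr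
    linarith
  simp [this.deriv_eq]

/-- The derivative of the cutoff is nonnegative, has integral one and concentrates on `[b, b +
1/(n+1)]`: it is an approximate identity acting from the right of `b`. -/
theorem tendsto_integral_deriv_cutoff_mul {b c : ℝ} (hbc : b < c) {w : ℝ → ℝ}
    (hw : ContinuousOn w (Icc b c)) :
    Filter.Tendsto (fun n : ℕ => ∫ t in b..c, deriv (cutoff b n) t * w t) Filter.atTop
      (nhds (w b)) := by
  rw [Metric.tendsto_nhds]
  intro ε hε
  obtain ⟨δ, hδ, hδw⟩ := Metric.continuousWithinAt_iff.1 (hw b (left_mem_Icc.2 hbc.le)) (ε / 2)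
    (half_pos hε)
  filter_upwards [eventually_one_le_mul (half_pos hδ), eventually_one_le_mul (sub_pos.2 hbc)]
    with n hn hn'
  have hd := continuous_deriv_cutoff b n
  have hone : ∫ t in b..c, deriv (cutoff b n) t = 1 := by
    rw [intervalIntegral.integral_eq_sub_of_hasDerivAt (fun t _ => hasDerivAt_cutoff b n t)
      (hd.intervalIntegrable _ _), cutoff_eq_one hn', cutoff_eq_zero n le_rfl, sub_zero]
  have hi : IntervalIntegrable (fun t => deriv (cutoff b n) t * w t) volume b c :=
    (hd.continuousOn.mul (hw.mono (uIcc_of_le hbc.le).subset)).intervalIntegrable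
  have hsub : (∫ t in b..c, deriv (cutoff b n) t * w t) - w b =
      ∫ t in b..c, deriv (cutoff b n) t * (w t - w b) := by
    simp only [mul_sub]
    rw [intervalIntegral.integral_sub hi ((hd.mul_const _).intervalIntegrable _ _),
      intervalIntegral.integral_mul_const, hone, one_mul]
  have hnorm : ‖∫ t in b..c, deriv (cutoff b n) t * (w t - w b)‖ ≤
      ∫ t in b..c, deriv (cutoff b n) t * (ε / 2) := by
    refine intervalIntegral.norm_integral_le_of_norm_le hbc.le ?_
      ((hd.mul_const _).intervalIntegrable _ _)
    refine Filter.Eventually.of_forall fun t ht => ?_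
    have hd0 : 0 ≤ deriv (cutoff b n) t := (monotone_cutoff b n).deriv_nonneg
    rw [norm_mul, Real.norm_of_nonneg hd0]
    rcases lt_or_ge (b + δ / 2) t with h | h
    · rw [deriv_cutoff_of_gt hn h, zero_mul, zero_mul]
    · refine mul_le_mul_of_nonneg_left ?_ hd0
      have := hδw (Ioc_subset_Icc_self ht) (by
        rw [Real.dist_eq, abs_of_pos (sub_pos.2 ht.1)]
        linarith)
      rw [← dist_eq_norm]
      exact this.le
  rw [intervalIntegral.integral_mul_const, hone, one_mul] at hnorm
  rw [dist_eq_norm, hsub]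
  linarith

/-- Dominated convergence: the cutoff has values in `[0,1]` and is eventually `1` at each point of
`(b,c]`. -/
theorem tendsto_integral_cutoff_mul {b c : ℝ} (hbc : b < c) {g : ℝ → ℝ}
    (hg : IntervalIntegrable g volume b c) :
    Filter.Tendsto (fun n : ℕ => ∫ t in b..c, cutoff b n t * g t) Filter.atTop
      (nhds (∫ t in b..c, g t)) := by
  refine intervalIntegral.tendsto_integral_filter_of_dominated_convergence (fun t => ‖g t‖)
    ?_ ?_ hg.norm ?_
  · refine Filter.Eventually.of_forall fun n => ?_
    exact ((contDiff_cutoff b n (m := 0)).continuous.aestronglyMeasurable).mul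
      (intervalIntegrable_iff.1 hg).aestronglyMeasurable
  · refine Filter.Eventually.of_forall fun n => Filter.Eventually.of_forall fun t _ => ?_
    rw [norm_mul, cutoff, Real.norm_of_nonneg (Real.smoothTransition.nonneg _)]
    exact mul_le_of_le_one_left (norm_nonneg _) (Real.smoothTransition.le_one _)
  · refine Filter.Eventually.of_forall fun t ht => ?_
    rw [uIoc_of_le hbc.le] at ht
    refine tendsto_const_nhds.congr' ?_
    filter_upwards [eventually_one_le_mul (sub_pos.2 ht.1)] with n hn
    rw [cutoff_eq_one hn, one_mul]

/-- The boundary conditions of `φ` are known from time `b` on only; before `b` the cutoff vanishes.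
-/
theorem IsTest.cutoff {L s b τ : ℝ} {φ : ℝ → ℝ → ℝ} (hφ : IsTest L b τ φ) (n : ℕ) :
    IsTest L s τ fun t x => cutoff b n t * φ t x where
  contDiff := by
    have h : ContDiff ℝ 3 (KdV.cutoff b n) := contDiff_cutoff b n (m := 3)
    exact (h.comp contDiff_fst).mul hφ.contDiff
  left t ht := by
    rcases le_total t b with h | h
    · simp [cutoff_eq_zero n h]
    · simp [hφ.left t ⟨h, ht.2⟩]
  right t ht := by
    rcases le_total t b with h | h
    · simp [cutoff_eq_zero n h]
    · simp [hφ.right t ⟨h, ht.2⟩]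
  deriv_left t ht := by
    rcases le_total t b with h | h
    · simp [cutoff_eq_zero n h]
    · rw [deriv_const_mul_field, hφ.deriv_left t ⟨h, ht.2⟩, mul_zero]

/-- The product rule adds a single term, carrying the derivative of the cutoff; in the limit it
produces the datum at time `b`. -/
theorem density_cutoff {L b : ℝ} (f : ℝ → L2 L) (h : ℝ → ℝ) (y : ℝ → L2 L) {φ : ℝ → ℝ → ℝ}
    (hφ : ContDiff ℝ 3 fun p : ℝ × ℝ => φ p.1 p.2) (n : ℕ) (t : ℝ) :
    density f h y (fun t x => cutoff b n t * φ t x) t =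
      deriv (cutoff b n) t * inner ℝ (toL2 L (φ t)) (y t) +
        cutoff b n t * density f h y φ t := by
  have hφt := continuous_slice hφ.continuous t
  have hA := continuous_slice (continuous_adjointOp hφ) t
  have hadj : adjointOp (fun t x => cutoff b n t * φ t x) t = fun x =>
      deriv (cutoff b n) t * φ t x + cutoff b n t * adjointOp φ t x := by
    funext x
    have h1 : deriv (fun r => cutoff b n r * φ r x) t =
        deriv (cutoff b n) t * φ t x + cutoff b n t * deriv (fun r => φ r x) t :=
      ((hasDerivAt_cutoff b n t).mul
        (hasDerivAt_left (by norm_num) hφ t x).differentiableAt.hasDerivAt).deriv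
    have h3 : iteratedDeriv 3 (fun x => cutoff b n t * φ t x) x =
        cutoff b n t * iteratedDeriv 3 (φ t) x := iteratedDeriv_const_mul_field _ _
    simp only [adjointOp, h1, h3, deriv_const_mul_field]
    ring
  simp only [density, hadj, deriv_const_mul_field]
  rw [toL2_add L (hφt.const_mul _) (hA.const_mul _), toL2_const_mul L _ hφt,
    toL2_const_mul L _ hφt, toL2_const_mul L _ hA]
  simp only [inner_add_left, inner_smul_left, RCLike.conj_to_real]
  ring

section Restart

variable {L s T τ : ℝ} {f : ℝ → L2 L} {h : ℝ → ℝ} {y : ℝ → L2 L} {y₀ : L2 L}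

/-- Testing with the cutoff times `φ` removes the datum at `s` and the whole contribution of
`[s,b]`. As `n → ∞`, the term with the derivative of the cutoff tends to `⟨φ(b), y(b)⟩`, by
continuity of `y`, and the rest tends to the integral of the density of `φ`. -/
theorem weakIdentity_restart (hf : IntegrableOn f (Icc s T))
    (hh : MemLp h 2 (volume.restrict (Icc s T))) (hy : ContinuousOn y (Icc s T))
    (hτ : τ ∈ Icc s T)
    (hw : ∀ φ : ℝ → ℝ → ℝ, IsTest L s τ φ → WeakIdentity s τ f h y₀ y φ)
    {b : ℝ} (hb : s < b) (hbτ : b ≤ τ) {φ : ℝ → ℝ → ℝ} (hφ : IsTest L b τ φ) :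
    WeakIdentity b τ f h (y b) y φ := by
  rcases hbτ.eq_or_lt with rfl | hbτ
  · simp [WeakIdentity]
  have hs : s ∈ Icc s T := left_mem_Icc.2 (hτ.1.trans hτ.2)
  have hbm : b ∈ Icc s T := ⟨hb.le, hbτ.le.trans hτ.2⟩
  have hyi : IntegrableOn y (Icc s T) := hy.integrableOn_Icc
  have hsub : Icc b τ ⊆ Icc s T := Icc_subset_Icc hb.le hτ.2
  have hwc : ContinuousOn (fun t => inner ℝ (toL2 L (φ t)) (y t)) (Icc b τ) :=
    (continuous_toL2 L hφ.contDiff.continuous).continuousOn.inner (hy.mono hsub)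
  have hg : IntervalIntegrable (density f h y φ) volume b τ :=
    intervalIntegrable_of_integrableOn_Icc (integrableOn_density hf hh hyi hφ.contDiff) hbm hτ
  have hlim := (tendsto_integral_deriv_cutoff_mul hbτ hwc).add (tendsto_integral_cutoff_mul hbτ hg)
  -- For large `n` the cutoff equals `1` at `τ`, so the tested identity equates the fixed number
  -- `⟨φ(τ), y(τ)⟩` with the `n`-th term of the sequence.
  refine tendsto_nhds_unique (tendsto_const_nhds.congr' ?_) hlim
  filter_upwards [eventually_one_le_mul (sub_pos.2 hbτ)] with n hn
  have hid := hw _ (hφ.cutoff n)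
  have hi := integrableOn_density (φ := fun t x => cutoff b n t * φ t x) hf hh hyi
    (hφ.cutoff (s := s) n).contDiff
  have hz : ∫ t in s..b, density f h y (fun t x => cutoff b n t * φ t x) t = 0 := by
    refine intervalIntegral.integral_zero_ae ?_
    have hne : ∀ᵐ t : ℝ, t ≠ b := by simp [ae_iff]
    filter_upwards [hne] with t ht hmem
    rw [uIoc_of_le hb.le] at hmem
    rw [density_cutoff f h y hφ.contDiff, deriv_cutoff_of_lt n (lt_of_le_of_ne hmem.2 ht),
      cutoff_eq_zero n hmem.2]
    ring
  rw [WeakIdentity, ← intervalIntegral.integral_add_adjacent_intervals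
    (intervalIntegrable_of_integrableOn_Icc hi hs hbm)
    (intervalIntegrable_of_integrableOn_Icc hi hbm hτ), hz,
    toL2_const_mul L _ (continuous_slice hφ.contDiff.continuous _),
    toL2_const_mul L _ (continuous_slice hφ.contDiff.continuous _), cutoff_eq_one hn,
    cutoff_eq_zero n hb.le] at hid
  simp only [one_smul, zero_smul, inner_zero_left, zero_add] at hid
  rw [hid]
  simp only [density_cutoff f h y hφ.contDiff]
  refine intervalIntegral.integral_add ?_ ?_
  · exact ((continuous_deriv_cutoff b n).continuousOn.mul
      (hwc.mono (uIcc_of_le hbτ.le).subset)).intervalIntegrable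
  · exact hg.continuousOn_mul (contDiff_cutoff b n (m := 0)).continuous.continuousOn

/-- A continuous weak solution attains its initial datum. -/
theorem initial_eq_of_weakIdentity (hsT : s < T) (hf : IntegrableOn f (Icc s T))
    (hh : MemLp h 2 (volume.restrict (Icc s T))) (hy : ContinuousOn y (Icc s T))
    (hw : ∀ᵐ τ ∂(volume.restrict (Icc s T)), ∀ φ : ℝ → ℝ → ℝ, IsTest L s τ φ →
      WeakIdentity s τ f h y₀ y φ) : y s = y₀ := by
  rw [← sub_eq_zero]
  refine eq_zero_of_forall_integral_eq_zero fun ψ h1 _ h3 => ?_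
  have hψ0 : ∀ x, x ∉ Ioo 0 L → ψ x = 0 := fun x hx =>
    image_eq_zero_of_notMem_tsupport fun h => hx (h3 h)
  have hψd : deriv ψ 0 = 0 := by
    refine image_eq_zero_of_notMem_tsupport fun h => ?_
    exact (h3 (closure_minimal (support_deriv_subset) (isClosed_tsupport ψ) h)).1.false
  -- A time-independent function supported inside `(0,L)` is a test function for every `τ`.
  have htest : ∀ τ, IsTest L s τ fun _ => ψ := fun τ =>
    ⟨(show ContDiff ℝ 3 ψ by exact_mod_cast contDiff_infty.1 h1 3).comp contDiff_snd,
      fun _ _ => hψ0 0 (by simp), fun _ _ => hψ0 L (by simp), fun _ _ => hψd⟩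
  have hi := integrableOn_density (φ := fun _ => ψ) hf hh hy.integrableOn_Icc
    (htest s).contDiff
  have hae : (fun τ => inner ℝ (toL2 L ψ) (y τ)) =ᵐ[volume.restrict (Icc s T)]
      fun τ => inner ℝ (toL2 L ψ) y₀ + ∫ t in s..τ, density f h y (fun _ => ψ) t := by
    filter_upwards [hw] with τ hτ
    exact hτ _ (htest τ)
  have hcont : ContinuousOn (fun τ => inner ℝ (toL2 L ψ) y₀ +
      ∫ t in s..τ, density f h y (fun _ => ψ) t) (Icc s T) := by
    have hp := intervalIntegral.continuousOn_primitive_interval (a := s) (b := T) (μ := volume)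
      (f := density f h y fun _ => ψ) (by rwa [uIcc_of_le hsT.le])
    rw [uIcc_of_le hsT.le] at hp
    exact continuousOn_const.add hp
  -- Both sides are continuous in `τ`, so the almost everywhere identity holds at `τ = s`, where the
  -- integral is zero.
  have he := Measure.eqOn_Icc_of_ae_eq volume hsT.ne hae (continuousOn_const.inner hy) hcont
    (left_mem_Icc.2 hsT.le)
  simp only [intervalIntegral.integral_same, add_zero] at he
  rw [integral_mul_eq_inner' h1.continuous, inner_sub_right, he, sub_self]

end Restart

/-! ### The two formulations -/

/-- Test with the projection of `φ`: its normal derivative at `L` vanishes, so the boundary datum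
disappears, and self-adjointness moves `P_M` onto the remaining data. -/
theorem WeakIdentity.PM {L : ℝ} (hL : 0 < L) {s τ : ℝ} (hsτ : s ≤ τ) {f : ℝ → L2 L} {h : ℝ → ℝ}
    {y₀ : L2 L} {y : ℝ → L2 L}
    (hw : ∀ φ : ℝ → ℝ → ℝ, IsTest L s τ φ → WeakIdentity s τ f h y₀ y φ)
    {φ : ℝ → ℝ → ℝ} (hφ : IsTest L s τ φ) :
    WeakIdentity s τ (fun t => PM L (f t)) (fun _ => 0) (PM L y₀) (fun t => PM L (y t)) φ := by
  obtain ⟨ψ, hψ, hψd, hψP, hψA⟩ := hφ.exists_projection hL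
  have hid := hw ψ hψ
  rw [WeakIdentity, hψP, hψP, inner_PM, inner_PM] at hid
  rw [WeakIdentity, hid]
  congr 1
  refine intervalIntegral.integral_congr fun t ht => ?_
  rw [uIcc_of_le hsτ] at ht
  simp only [density]
  rw [hψA t ht, hψd, hψP, inner_PM]
  ring

theorem density_add {L : ℝ} (f₁ f₂ : ℝ → L2 L) (h₁ h₂ : ℝ → ℝ) (y₁ y₂ : ℝ → L2 L)
    (φ : ℝ → ℝ → ℝ) (t : ℝ) :
    density (fun t => f₁ t + f₂ t) (fun t => h₁ t + h₂ t) (fun t => y₁ t + y₂ t) φ t =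
      density f₁ h₁ y₁ φ t + density f₂ h₂ y₂ φ t := by
  simp only [density, inner_add_right]
  ring

/-- Linearity, in a form that serves both directions of the equivalence: subtracting the equation of
`P_M y` and adding it back. -/
theorem weakIdentity_add_iff {L s τ : ℝ} {f₁ f₂ : ℝ → L2 L} {h₁ h₂ : ℝ → ℝ} {a₁ a₂ : L2 L}
    {y₁ y₂ : ℝ → L2 L} {φ : ℝ → ℝ → ℝ}
    (i₁ : IntervalIntegrable (density f₁ h₁ y₁ φ) volume s τ)
    (i₂ : IntervalIntegrable (density f₂ h₂ y₂ φ) volume s τ)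
    (w₂ : WeakIdentity s τ f₂ h₂ a₂ y₂ φ) :
    WeakIdentity s τ (fun t => f₁ t + f₂ t) (fun t => h₁ t + h₂ t) (a₁ + a₂)
      (fun t => y₁ t + y₂ t) φ ↔ WeakIdentity s τ f₁ h₁ a₁ y₁ φ := by
  simp only [WeakIdentity, density_add, inner_add_right] at w₂ ⊢
  rw [intervalIntegral.integral_add i₁ i₂, w₂]
  constructor <;> intro <;> linarith

end KdV

end

theorem proposition1 (L : ℝ) (hL : 0 < L) (u : ℝ → KdV.L2 L → ℝ) (hu : KdV.IsCaratheodory u)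
    (s T : ℝ) (hsT : s < T) (y : ℝ → KdV.L2 L) (hy : KdV.MemB s T y) (y₀ : KdV.L2 L) :
    KdV.IsClosedLoopCauchySolution u s y₀ (Set.Icc s T) y ↔
      KdV.IsCoupledSolution u s T y₀
        (fun t => KdV.PH L (y t)) (fun t => KdV.PM L (y t)) := by
  have hPM : KdV.MemB s T fun t => KdV.PM L (y t) := hy.PM hL
  have hPH : KdV.MemB s T fun t => KdV.PH L (y t) := by
    simpa only [KdV.PH_eq] using hy.sub hPM
  have hyi : IntegrableOn y (Icc s T) := hy.continuousOn.integrableOn_Icc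
  have hPMi := hPM.continuousOn.integrableOn_Icc (μ := volume)
  have hPHi := hPH.continuousOn.integrableOn_Icc (μ := volume)
  have hsum : (fun t => KdV.PH L (y t) + KdV.PM L (y t)) = y :=
    funext fun t => KdV.PH_add_PM (y t)
  have hf : (fun t => -KdV.PH L (KdV.nonlin (y t)) + -KdV.PM L (KdV.nonlin (y t))) =
      fun t => 0 - KdV.nonlin (y t) := by
    funext t
    rw [← neg_add, KdV.PH_add_PM, zero_sub]
  have hsmem : s ∈ Icc s T := left_mem_Icc.2 hsT.le
  constructor
  · intro hsol
    obtain ⟨hfi, hh, -, hw⟩ := KdV.isLinearSolution_iff.1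
      (hsol.closedLoop.solution s T hsT subset_rfl).linear
    rw [hsol.initial] at hw
    -- Integrability of the nonlinearity is part of the notion of solution; bounded operators then
    -- transfer it to both projections.
    have hni : IntegrableOn (fun t => KdV.nonlin (y t)) (Icc s T) := by
      simpa [IntegrableOn] using Integrable.neg hfi
    have hPHf : IntegrableOn (fun t => -KdV.PH L (KdV.nonlin (y t))) (Icc s T) :=
      ((KdV.PH L).integrable_comp hni).neg
    have hPMf : IntegrableOn (fun t => -KdV.PM L (KdV.nonlin (y t))) (Icc s T) :=
      ((KdV.PM L).integrable_comp hni).neg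
    have hw₂ : ∀ᵐ τ ∂(volume.restrict (Icc s T)), ∀ φ : ℝ → ℝ → ℝ, KdV.IsTest L s τ φ →
        KdV.WeakIdentity s τ (fun t => -KdV.PM L (KdV.nonlin (y t))) (fun _ => 0)
          (KdV.PM L y₀) (fun t => KdV.PM L (y t)) φ := by
      filter_upwards [hw, ae_restrict_mem measurableSet_Icc] with τ h1 hτ φ hφ
      simpa using KdV.WeakIdentity.PM hL hτ.1 h1 hφ
    refine ⟨hPH, hPM, KdV.isLinearSolution_iff.2 ?_, KdV.isLinearSolution_iff.2 ?_⟩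
    · simp only [KdV.PH_add_PM]
      refine ⟨hPHf, hh, hPHi, ?_⟩
      filter_upwards [hw, hw₂, ae_restrict_mem measurableSet_Icc] with τ h1 h2 hτ φ hφ
      have i₁ := KdV.intervalIntegrable_of_integrableOn_Icc
        (KdV.integrableOn_density hPHf hh hPHi hφ.contDiff) hsmem hτ
      have i₂ := KdV.intervalIntegrable_of_integrableOn_Icc
        (KdV.integrableOn_density (h := fun _ => 0) hPMf MemLp.zero hPMi hφ.contDiff) hsmem hτ
      refine (KdV.weakIdentity_add_iff i₁ i₂ (h2 φ hφ)).1 ?_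
      simpa only [hf, hsum, add_zero, KdV.PH_add_PM] using h1 φ hφ
    · simp only [KdV.PH_add_PM]
      exact ⟨hPMf, MemLp.zero, hPMi, hw₂⟩
  · rintro ⟨-, -, hl₁, hl₂⟩
    simp only [KdV.PH_add_PM] at hl₁ hl₂
    obtain ⟨hPHf, hh, -, hw₁⟩ := KdV.isLinearSolution_iff.1 hl₁
    obtain ⟨hPMf, hh₀, -, hw₂⟩ := KdV.isLinearSolution_iff.1 hl₂
    have hfi : IntegrableOn (fun t => 0 - KdV.nonlin (y t)) (Icc s T) := by
      rw [← hf]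
      exact Integrable.add hPHf hPMf
    have hw : ∀ᵐ τ ∂(volume.restrict (Icc s T)), ∀ φ : ℝ → ℝ → ℝ, KdV.IsTest L s τ φ →
        KdV.WeakIdentity s τ (fun t => 0 - KdV.nonlin (y t)) (fun t => u t (y t)) y₀ y φ := by
      filter_upwards [hw₁, hw₂, ae_restrict_mem measurableSet_Icc] with τ h1 h2 hτ φ hφ
      have i₁ := KdV.intervalIntegrable_of_integrableOn_Icc
        (KdV.integrableOn_density hPHf hh hPHi hφ.contDiff) hsmem hτ
      have i₂ := KdV.intervalIntegrable_of_integrableOn_Icc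
        (KdV.integrableOn_density hPMf hh₀ hPMi hφ.contDiff) hsmem hτ
      have := (KdV.weakIdentity_add_iff i₁ i₂ (h2 φ hφ)).2 (h1 φ hφ)
      simpa only [hf, hsum, add_zero, KdV.PH_add_PM] using this
    have hinit : y s = y₀ := KdV.initial_eq_of_weakIdentity hsT hfi hh hy.continuousOn hw
    refine ⟨ordConnected_Icc, ?_, ?_, ⟨hy.continuousOn, fun T₁ T₂ h12 hsub => ?_⟩, hinit⟩
    · rw [interior_Icc]
      exact nonempty_Ioo.2 hsT
    · ext t
      simp only [mem_inter_iff, mem_Icc, mem_Iic, mem_singleton_iff]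
      constructor
      · rintro ⟨⟨h, -⟩, h'⟩
        exact le_antisymm h' h
      · rintro rfl
        exact ⟨⟨le_rfl, hsT.le⟩, le_rfl⟩
    · refine ⟨hy.mono hsub, KdV.isLinearSolution_iff.2 ⟨hfi.mono_set hsub,
        hh.mono_measure (Measure.restrict_mono_set _ hsub), hyi.mono_set hsub, ?_⟩⟩
      filter_upwards [ae_restrict_of_ae_restrict_of_subset hsub hw,
        ae_restrict_mem measurableSet_Icc] with τ h1 hτ φ hφ
      -- At `T₁ = s` the datum is `y₀`, identified by `hinit`; any later starting time requires the
      -- restart.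
      rcases (hsub (left_mem_Icc.2 h12.le)).1.eq_or_lt with rfl | hlt
      · rw [hinit]
        exact h1 φ hφ
      · exact KdV.weakIdentity_restart hfi hh hy.continuousOn (hsub hτ) h1 hlt hτ.1 hφ
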